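/- **Lemma 2.1.** Let $T$ be a positive (that is, $\langle Tx,x\rangle\ge 0$ for $x$ in its domain), possibly unbounded, self-adjoint operator on a complex Hilbert space $\mathcal H$, with spectral decomposition $T=\int_0^\infty\lambda\,dP_\lambda$, and let $P$ be the orthogonal projection onto the null space of $T$. Let $l\ge 1$ be an integer, let $f_0\not\equiv 0$ be the restriction to $\mathbb R^+$ of a function in $\mathcal S(\mathbb R)$ (complex-valued), and let $f(s)=s^l f_0(s)$. For $t>0$ let $|f|^2(tT)=\int_0^\infty |f(t\lambda)|^2\,dP_\lambda$, a bounded operator on $\mathcal H$. Set $c=\int_0^\infty |f(t)|^2\,\frac{dt}{t}$; this integral is finite. (a) For $0<\varepsilon<N<\infty$ the operator-valued function $t\mapsto \frac1t|f|^2(tT)$ is integrable on $[\varepsilon,N]$ in the operator norm, and for every $F\in\mathcal H$ $$\lim_{\varepsilon\to0^+,\,N\to\infty}\left[\int_\varepsilon^N |f|^2(tT)\,\frac{dt}{t}\right]F=c(I-P)F .$$ Thus $\int_0^\infty |f|^2(tT)\frac{dt}{t}$, defined as this limit, exists in the strong operator topology and equals $c(I-P)$. (b) Let $a>0$, $a\ne1$,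 and suppose that there are constants $A_a,B_a$ such that for all $s>0$ $$0<A_a\le\sum_{j=-\infty}^{\infty}|f(a^{2j}s)|^2\le B_a<\infty .$$ Then the limit $\sum_{j=-\infty}^\infty|f|^2(a^{2j}T):=\lim_{M,N\to\infty}\sum_{j=-M}^N|f|^2(a^{2j}T)$ exists in the strong operator topology on $\mathcal H$, and $$A_a(I-P)\le\sum_{j=-\infty}^\infty|f|^2(a^{2j}T)\le B_a(I-P).$$ -/

import Mathlib

open MeasureTheory Set Filter Topology
open scoped InnerProductSpace SchwartzMap

/-- A resolution of the identity `(P_s)` on a complex Hilbert space: an increasing, strongly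
right-continuous family of orthogonal projections, indexed by the real line, which tends strongly
to `0` at `-∞` and to the identity at `+∞`. -/
structure SpectralFamily (H : Type*) [NormedAddCommGroup H] [InnerProductSpace ℂ H]
    [CompleteSpace H] where
  /-- The projection `P_s = P_{(-∞, s]}`. -/
  proj : ℝ → H →L[ℂ] H
  isStarProjection : ∀ s, IsStarProjection (proj s)
  proj_mul_proj : ∀ s t, s ≤ t → proj s * proj t = proj s
  right_continuous : ∀ s x, Tendsto (fun t => proj t x) (𝓝[>] s) (𝓝 (proj s x))
  tendsto_atBot : ∀ x, Tendsto (fun t => proj t x) atBot (𝓝 0)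
  tendsto_atTop : ∀ x, Tendsto (fun t => proj t x) atTop (𝓝 x)

namespace SpectralFamily

variable {H : Type*} [NormedAddCommGroup H] [InnerProductSpace ℂ H] [CompleteSpace H]

theorem norm_proj_mono (E : SpectralFamily H) (x : H) : Monotone fun s => ‖E.proj s x‖ := by
  intro s t hst
  have h1 : E.proj s x = E.proj s (E.proj t x) := by
    rw [← ContinuousLinearMap.comp_apply, ← ContinuousLinearMap.mul_def, E.proj_mul_proj s t hst]
  have h2 : ‖E.proj s‖ ≤ 1 := (E.isStarProjection s).norm_le
  calc ‖E.proj s x‖ = ‖E.proj s (E.proj t x)‖ := by rw [← h1]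
    _ ≤ 1 * ‖E.proj t x‖ := (E.proj s).le_of_opNorm_le h2 _
    _ = ‖E.proj t x‖ := one_mul _

/-- The distribution function `s ↦ ⟪x, P_s x⟫ = ‖P_s x‖²`. -/
noncomputable def distribution (E : SpectralFamily H) (x : H) : StieltjesFunction ℝ where
  toFun s := ‖E.proj s x‖ ^ 2
  mono' := fun _ _ hst => pow_le_pow_left₀ (norm_nonneg _) (E.norm_proj_mono x hst) 2
  right_continuous' := fun s =>
    continuousWithinAt_Ioi_iff_Ici.mp ((E.right_continuous s x).norm.pow 2)

/-- The measure `d⟪x, P_s x⟫` on the real line. -/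
noncomputable def measure (E : SpectralFamily H) (x : H) : Measure ℝ := (E.distribution x).measure

/-- `E` is the spectral decomposition of `T`, that is `T = ∫ s dP_s`: the domain of `T` consists of
the `x` with `∫ s² d⟪x, P_s x⟫ < ∞`, and `⟪x, T x⟫ = ∫ s d⟪x, P_s x⟫` for these `x`. -/
def Resolves (E : SpectralFamily H) (T : H →ₗ.[ℂ] H) : Prop :=
  (∀ x : H, x ∈ T.domain ↔ Integrable (fun s : ℝ => s ^ 2) (E.measure x)) ∧
    ∀ x : T.domain, ⟪(x : H), T x⟫_ℂ = ((∫ s, s ∂(E.measure (x : H)) : ℝ) : ℂ)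

/-- `S = ∫ g dP_s` in the weak sense: `⟪x, S x⟫ = ∫ g d⟪x, P_s x⟫` for all `x`. There is at most
one such bounded operator `S`, by polarization, and there is one for each bounded Borel `g`. -/
def IsIntegral (E : SpectralFamily H) (g : ℝ → ℝ) (S : H →L[ℂ] H) : Prop :=
  ∀ x : H, Integrable g (E.measure x) ∧ ⟪x, S x⟫_ℂ = ((∫ s, g s ∂(E.measure x) : ℝ) : ℂ)

open Classical in
/-- The bounded operator `∫ g dP_s` (and `0` if there is no such operator). -/
noncomputable def integral (E : SpectralFamily H) (g : ℝ → ℝ) : H →L[ℂ] H :=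
  if h : ∃ S, E.IsIntegral g S then h.choose else 0

end SpectralFamily

namespace LinearPMap

variable {H : Type*} [NormedAddCommGroup H] [InnerProductSpace ℂ H]

open Classical in
/-- The functional calculus `g(T) = ∫ g dP_s`, for `T = ∫ s dP_s` self-adjoint and `g` a bounded
real Borel function. The spectral decomposition of `T`, which the spectral theorem provides, is the
same for all `g` (the value is `0` if `T` has no spectral decomposition). -/
noncomputable def funcCalc [CompleteSpace H] (T : H →ₗ.[ℂ] H) (g : ℝ → ℝ) : H →L[ℂ] H :=
  if h : ∃ E : SpectralFamily H, E.Resolves T then h.choose.integral g else 0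

/-- `|f|²(tT) = ∫ |f(t s)|² dP_s`, for `T = ∫ s dP_s`. -/
noncomputable def absSqDilate [CompleteSpace H] (T : H →ₗ.[ℂ] H) (f : ℝ → ℂ) (t : ℝ) : H →L[ℂ] H :=
  T.funcCalc fun s => ‖f (t * s)‖ ^ 2

/-- The null space of `T`, as a subspace of the Hilbert space. -/
def nullSpace (T : H →ₗ.[ℂ] H) : Submodule ℂ H := (LinearMap.ker T.toFun).map T.domain.subtype

theorem mem_nullSpace {T : H →ₗ.[ℂ] H} {x : H} :
    x ∈ T.nullSpace ↔ ∃ h : x ∈ T.domain, T ⟨x, h⟩ = 0 := by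
  simp [nullSpace]

/-- The null space of a self-adjoint operator is closed, so that the closure in the definition of
`nullProj` changes nothing there. -/
theorem isClosed_nullSpace [CompleteSpace H] {T : H →ₗ.[ℂ] H} (hT : IsSelfAdjoint T) :
    _root_.IsClosed (T.nullSpace : Set H) := by
  have h : (T.nullSpace : Set H) = (fun x : H => (x, (0 : H))) ⁻¹' (T.graph : Set (H × H)) := by
    ext x
    simp [mem_nullSpace, LinearPMap.mem_graph_iff]
  rw [h]
  exact hT.isClosed.preimage (by fun_prop)

/-- The orthogonal projection onto the null space of `T`. -/
noncomputable def nullProj [CompleteSpace H] (T : H →ₗ.[ℂ] H) : H →L[ℂ] H :=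
  T.nullSpace.topologicalClosure.starProjection

end LinearPMap

/-! For `x` in `H` let μ_x be the finite measure d⟪x, P_λ x⟫; positivity of `T` makes it live on [0,
∞). Both statements reduce to scalar ones there. Since dt/t is dilation invariant, ∫_ε^N |f(tλ)|²
dt/t tends to `c` for λ > 0, while it is 0 at λ = 0 because f(0) = 0. The limit function is thus `c`
times the indicator of (0, ∞), whose operator is 1 - P_0, and P_0 is the projection onto the null
space (`Resolves.nullProj_eq`). In (b) the bounds hold for λ > 0 and the sum vanishes at λ = 0, so
the operator inequalities follow from pointwise inequalities between integrands.

Strong convergence comes from weak: if 0 ≤ D ≤ K, then ‖D x‖² ≤ K ⟪x, D x⟫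
(`IsPositive.norm_apply_sq_le`). Applied to the remainder of the truncated integral and to finite
blocks of the series, it leaves only the convergence of scalar integrals against μ_x
(`tendsto_intervalIntegral_dilate`, `exists_hasSum_isIntegral`).

The functional calculus is built on a chosen spectral family of `T`, so one must exist
(`LinearPMap.exists_resolves`). The resolvent R = (1 + T)⁻¹ is bounded with 0 ≤ R ≤ 1, and the
subspace "T ≤ s" is the kernel of the negative part of (1 + s) R - 1. The measure of R x has density
(1 + λ)⁻² with respect to that of x, which recovers the domain and the quadratic form of `T`. -/

/-! ### Positive bounded operators. -/

namespace ContinuousLinearMap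

variable {H : Type*} [NormedAddCommGroup H] [InnerProductSpace ℂ H]

/-- With R = √D one has ‖D x‖² = ⟪R x, D (R x)⟫ ≤ K ‖R x‖² = K ⟪x, D x⟫. This upgrades weak
convergence of positive operators to strong convergence. -/
theorem IsPositive.norm_apply_sq_le [CompleteSpace H] {D : H →L[ℂ] H} (hD : D.IsPositive) {K : ℝ}
    (hK : ∀ x, (⟪x, D x⟫_ℂ).re ≤ K * ‖x‖ ^ 2) (x : H) :
    ‖D x‖ ^ 2 ≤ K * (⟪x, D x⟫_ℂ).re := by
  have h0 : 0 ≤ D := (nonneg_iff_isPositive D).2 hD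
  set R := CFC.sqrt D with hR
  have hRR : R * R = D := CFC.sqrt_mul_sqrt_self D h0
  have hRs : R.IsPositive := (nonneg_iff_isPositive R).1 (CFC.sqrt_nonneg D)
  have key : ∀ y, ‖R y‖ ^ 2 = (⟪y, D y⟫_ℂ).re := by
    intro y
    rw [← hRR, mul_apply_eq_comp, ← hRs.inner_left_eq_inner_right, inner_self_eq_norm_sq_to_K]
    norm_cast
  have h1 : ‖D x‖ = ‖R (R x)‖ := by rw [← mul_apply_eq_comp, hRR]
  calc ‖D x‖ ^ 2 = (⟪R x, D (R x)⟫_ℂ).re := by rw [h1, key]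
    _ ≤ K * ‖R x‖ ^ 2 := hK _
    _ = K * (⟪x, D x⟫_ℂ).re := by rw [key]

theorem isPositive_of_inner_eq {D : H →L[ℂ] H} {q : H → ℝ}
    (hD : ∀ x, ⟪x, D x⟫_ℂ = (q x : ℂ)) (hq : ∀ x, 0 ≤ q x) : D.IsPositive := by
  rw [isPositive_iff_complex]
  intro x
  have h : ⟪D x, x⟫_ℂ = (q x : ℂ) := by
    rw [← inner_conj_symm, hD, Complex.conj_ofReal]
  simp [h, hq]

theorem ext_inner {S S' : H →L[ℂ] H} (h : ∀ x, ⟪x, S x⟫_ℂ = ⟪x, S' x⟫_ℂ) : S = S' := by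
  have : (S : H →ₗ[ℂ] H) = S' := by
    rw [← ext_inner_map]
    intro x
    have := congrArg (starRingEnd ℂ) (h x)
    simpa using this
  ext x
  exact congrArg (fun A : H →ₗ[ℂ] H => A x) this

end ContinuousLinearMap

/-! ### Spectral measures and weak integrals of scalar functions. -/

namespace SpectralFamily

variable {H : Type*} [NormedAddCommGroup H] [InnerProductSpace ℂ H] [CompleteSpace H]
variable (E : SpectralFamily H)

theorem proj_apply_proj {s t : ℝ} (h : s ≤ t) (x : H) : E.proj s (E.proj t x) = E.proj s x := by
  rw [← mul_apply_eq_comp, E.proj_mul_proj s t h]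

theorem proj_apply_proj' {s t : ℝ} (h : s ≤ t) (x : H) : E.proj t (E.proj s x) = E.proj s x := by
  have h1 := congrArg star (E.proj_mul_proj s t h)
  rw [star_mul, (E.isStarProjection s).isSelfAdjoint.star_eq,
    (E.isStarProjection t).isSelfAdjoint.star_eq] at h1
  rw [← mul_apply_eq_comp, h1]

theorem inner_proj_apply (s : ℝ) (x y : H) : ⟪E.proj s x, y⟫_ℂ = ⟪x, E.proj s y⟫_ℂ := by
  have h := (E.isStarProjection s).isSelfAdjoint
  rw [ContinuousLinearMap.isSelfAdjoint_iff'] at h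
  conv_lhs => rw [← h]
  exact ContinuousLinearMap.adjoint_inner_left _ _ _

theorem inner_proj_self (s : ℝ) (x : H) : ⟪x, E.proj s x⟫_ℂ = ((‖E.proj s x‖ ^ 2 : ℝ) : ℂ) := by
  rw [← E.proj_apply_proj le_rfl, ← inner_proj_apply, inner_self_eq_norm_sq_to_K]
  simp [E.proj_apply_proj le_rfl]

theorem norm_proj_sub_sq {s t : ℝ} (h : s ≤ t) (x : H) :
    ‖E.proj t x - E.proj s x‖ ^ 2 = ‖E.proj t x‖ ^ 2 - ‖E.proj s x‖ ^ 2 := by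
  have h1 : ⟪E.proj t x, E.proj s x⟫_ℂ = ((‖E.proj s x‖ ^ 2 : ℝ) : ℂ) := by
    rw [inner_proj_apply, E.proj_apply_proj' h, inner_proj_self]
  rw [@norm_sub_sq ℂ, h1]
  simp only [RCLike.re_to_complex, Complex.ofReal_re]
  ring

@[simp]
theorem distribution_apply (x : H) (s : ℝ) : E.distribution x s = ‖E.proj s x‖ ^ 2 := rfl

theorem distribution_tendsto_atBot (x : H) : Tendsto (E.distribution x) atBot (𝓝 0) := by
  have h := (E.tendsto_atBot x).norm.pow 2
  rw [norm_zero, zero_pow two_ne_zero] at h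
  exact h

theorem distribution_tendsto_atTop (x : H) : Tendsto (E.distribution x) atTop (𝓝 (‖x‖ ^ 2)) :=
  (E.tendsto_atTop x).norm.pow 2

theorem measure_Iic (x : H) (s : ℝ) : E.measure x (Iic s) = ENNReal.ofReal (‖E.proj s x‖ ^ 2) := by
  rw [measure, StieltjesFunction.measure_Iic _ (E.distribution_tendsto_atBot x)]
  simp

theorem measure_univ (x : H) : E.measure x univ = ENNReal.ofReal (‖x‖ ^ 2) := by
  rw [measure, StieltjesFunction.measure_univ _ (E.distribution_tendsto_atBot x)
    (E.distribution_tendsto_atTop x)]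
  simp

theorem measure_Ioc (x : H) {s t : ℝ} (h : s ≤ t) :
    E.measure x (Ioc s t) = ENNReal.ofReal (‖E.proj t x - E.proj s x‖ ^ 2) := by
  rw [measure, StieltjesFunction.measure_Ioc, norm_proj_sub_sq _ h]
  simp

instance (x : H) : IsFiniteMeasure (E.measure x) :=
  ⟨by rw [measure_univ]; exact ENNReal.ofReal_lt_top⟩

theorem measureReal_univ (x : H) : (E.measure x).real univ = ‖x‖ ^ 2 := by
  rw [Measure.real, measure_univ, ENNReal.toReal_ofReal (by positivity)]

variable {E}

theorem IsIntegral.unique {g : ℝ → ℝ} {S S' : H →L[ℂ] H} (h : E.IsIntegral g S)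
    (h' : E.IsIntegral g S') : S = S' :=
  ContinuousLinearMap.ext_inner fun x => by rw [(h x).2, (h' x).2]

theorem IsIntegral.integral_eq {g : ℝ → ℝ} {S : H →L[ℂ] H} (h : E.IsIntegral g S) :
    E.integral g = S := by
  have h' : ∃ S, E.IsIntegral g S := ⟨S, h⟩
  rw [integral, dif_pos h']
  exact h'.choose_spec.unique h

theorem IsIntegral.zero : E.IsIntegral (fun _ => 0) 0 := fun x => ⟨by simp, by simp⟩

theorem IsIntegral.add {g g' : ℝ → ℝ} {S S' : H →L[ℂ] H} (h : E.IsIntegral g S)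
    (h' : E.IsIntegral g' S') : E.IsIntegral (fun s => g s + g' s) (S + S') := fun x =>
  ⟨(h x).1.add (h' x).1, by
    rw [integral_add (h x).1 (h' x).1, add_apply, inner_add_right, (h x).2,
      (h' x).2]
    push_cast; rfl⟩

theorem IsIntegral.sub {g g' : ℝ → ℝ} {S S' : H →L[ℂ] H} (h : E.IsIntegral g S)
    (h' : E.IsIntegral g' S') : E.IsIntegral (fun s => g s - g' s) (S - S') := fun x =>
  ⟨(h x).1.sub (h' x).1, by
    rw [integral_sub (h x).1 (h' x).1, sub_apply, inner_sub_right, (h x).2,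
      (h' x).2]
    push_cast; rfl⟩

theorem IsIntegral.const_mul {g : ℝ → ℝ} {S : H →L[ℂ] H} (h : E.IsIntegral g S) (c : ℝ) :
    E.IsIntegral (fun s => c * g s) ((c : ℂ) • S) := fun x =>
  ⟨(h x).1.const_mul c, by
    rw [integral_const_mul, smul_apply, inner_smul_right, (h x).2]
    push_cast; rfl⟩

theorem IsIntegral.sum {ι : Type*} {g : ι → ℝ → ℝ} {S : ι → H →L[ℂ] H} (F : Finset ι)
    (h : ∀ i ∈ F, E.IsIntegral (g i) (S i)) :
    E.IsIntegral (fun s => ∑ i ∈ F, g i s) (∑ i ∈ F, S i) := by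
  classical
  induction F using Finset.induction_on with
  | empty => simpa using IsIntegral.zero
  | insert i F hi ih =>
    simp only [Finset.sum_insert hi]
    exact (h i (by simp)).add (ih fun j hj => h j (by simp [hj]))

theorem isIntegral_indicator_Iic (s : ℝ) :
    E.IsIntegral ((Iic s).indicator fun _ => 1) (E.proj s) := fun x =>
  ⟨(integrable_const _).indicator measurableSet_Iic, by
    rw [integral_indicator_const _ measurableSet_Iic, Measure.real, measure_Iic, inner_proj_self,
      ENNReal.toReal_ofReal (by positivity)]
    simp⟩

theorem isIntegral_one : E.IsIntegral (fun _ => 1) 1 := fun x =>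
  ⟨integrable_const _, by
    simp [measureReal_univ, inner_self_eq_norm_sq_to_K]⟩

theorem isIntegral_indicator_Ioc {s t : ℝ} (h : s ≤ t) :
    E.IsIntegral ((Ioc s t).indicator fun _ => 1) (E.proj t - E.proj s) := by
  convert (isIntegral_indicator_Iic t).sub (isIntegral_indicator_Iic s) using 1
  ext r
  by_cases h1 : r ≤ s
  · simp [indicator, h1, h1.trans h]
  · by_cases h2 : r ≤ t <;> simp [indicator, h1, h2, lt_of_not_ge h1]

theorem IsIntegral.isPositive {g : ℝ → ℝ} {S : H →L[ℂ] H} (h : E.IsIntegral g S)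
    (hg : ∀ x, ∀ᵐ s ∂(E.measure x), 0 ≤ g s) : S.IsPositive :=
  ContinuousLinearMap.isPositive_of_inner_eq (fun x => (h x).2)
    fun x => integral_nonneg_of_ae (hg x)

theorem IsIntegral.re_inner_le {g : ℝ → ℝ} {S : H →L[ℂ] H} (h : E.IsIntegral g S) {K : ℝ}
    (hg : ∀ x, ∀ᵐ s ∂(E.measure x), g s ≤ K) (x : H) : (⟪x, S x⟫_ℂ).re ≤ K * ‖x‖ ^ 2 := by
  rw [(h x).2, Complex.ofReal_re, ← measureReal_univ E]
  refine (integral_mono_ae (h x).1 (integrable_const K) (hg x)).trans_eq ?_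
  simp [mul_comm]

/-- The bounds are only asked almost everywhere, since they will hold on [0, ∞), where the measures
of a positive operator live. -/
theorem IsIntegral.norm_apply_sq_le {g : ℝ → ℝ} {S : H →L[ℂ] H} (h : E.IsIntegral g S) {K : ℝ}
    (h0 : ∀ x, ∀ᵐ s ∂(E.measure x), 0 ≤ g s) (hK : ∀ x, ∀ᵐ s ∂(E.measure x), g s ≤ K) (x : H) :
    ‖S x‖ ^ 2 ≤ K * ∫ s, g s ∂(E.measure x) := by
  have := (h.isPositive h0).norm_apply_sq_le (h.re_inner_le hK) x
  rwa [(h x).2, Complex.ofReal_re] at this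

theorem IsIntegral.opNorm_le_of_nonneg {g : ℝ → ℝ} {S : H →L[ℂ] H} (h : E.IsIntegral g S) {K : ℝ}
    (hK0 : 0 ≤ K) (h0 : ∀ x, ∀ᵐ s ∂(E.measure x), 0 ≤ g s)
    (hK : ∀ x, ∀ᵐ s ∂(E.measure x), g s ≤ K) : ‖S‖ ≤ K := by
  refine ContinuousLinearMap.opNorm_le_bound _ hK0 fun x => ?_
  have h1 := (h.isPositive h0).norm_apply_sq_le (h.re_inner_le hK) x
  have h2 := mul_le_mul_of_nonneg_left (h.re_inner_le hK x) hK0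
  exact abs_le_of_sq_le_sq' (by nlinarith) (by positivity) |>.2

/-- Shifting by `K` makes the integrand take values in [0, 2K], where the bound for positive
operators applies; undoing the shift costs another `K`. The factor 3 is not sharp, but only norm
continuity and Cauchy estimates depend on it. -/
theorem IsIntegral.opNorm_le {g : ℝ → ℝ} {S : H →L[ℂ] H} (h : E.IsIntegral g S) {K : ℝ}
    (hK0 : 0 ≤ K) (hK : ∀ s, |g s| ≤ K) : ‖S‖ ≤ 3 * K := by
  have h1 : ‖S + (K : ℂ) • (1 : H →L[ℂ] H)‖ ≤ 2 * K := by
    refine (h.add (isIntegral_one.const_mul K)).opNorm_le_of_nonneg (by positivity) ?_ ?_ <;>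
    · refine fun x => ae_of_all _ fun s => ?_
      have := abs_le.1 (hK s)
      linarith
  have h2 : ‖(K : ℂ) • (1 : H →L[ℂ] H)‖ ≤ K := by
    refine ContinuousLinearMap.opNorm_le_bound _ hK0 fun x => ?_
    simp [norm_smul, abs_of_nonneg hK0]
  calc ‖S‖ = ‖S + (K : ℂ) • (1 : H →L[ℂ] H) - (K : ℂ) • (1 : H →L[ℂ] H)‖ := by simp
    _ ≤ _ := norm_sub_le _ _
    _ ≤ 3 * K := by linarith

/-- Uniform limits of integrable functions are integrable. -/
theorem exists_isIntegral_of_forall_approx {g : ℝ → ℝ}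
    (hg : ∀ ε : ℝ, 0 < ε → ∃ g' : ℝ → ℝ, ∃ S, E.IsIntegral g' S ∧ ∀ s, |g s - g' s| ≤ ε) :
    ∃ S, E.IsIntegral g S := by
  have hpos : ∀ n : ℕ, (0 : ℝ) < 1 / (n + 1) := fun n => by positivity
  choose G S hS hG using fun n : ℕ => hg (1 / (n + 1)) (hpos n)
  have hlim := tendsto_one_div_add_atTop_nhds_zero_nat (𝕜 := ℝ)
  -- The integrands differ by at most 2 / (N + 1), and `opNorm_le` contributes the factor 3.
  have hdiff : ∀ N m n : ℕ, N ≤ m → N ≤ n → ‖S m - S n‖ ≤ 6 * (1 / ((N : ℝ) + 1)) := by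
    intro N m n hm hn
    have h1 : (1 : ℝ) / (m + 1) ≤ 1 / (N + 1) := Nat.one_div_le_one_div hm
    have h2 : (1 : ℝ) / (n + 1) ≤ 1 / (N + 1) := Nat.one_div_le_one_div hn
    have := ((hS m).sub (hS n)).opNorm_le (K := 2 * (1 / ((N : ℝ) + 1))) (by positivity) fun s => by
      have a1 := abs_le.1 (hG m s)
      have a2 := abs_le.1 (hG n s)
      rw [abs_le]
      constructor <;> linarith
    linarith
  have hc : CauchySeq S := by
    refine cauchySeq_of_le_tendsto_0 (fun N : ℕ => 6 * (1 / ((N : ℝ) + 1))) ?_ ?_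
    · intro m n N hm hn
      rw [dist_eq_norm]
      exact hdiff N m n hm hn
    · simpa using hlim.const_mul 6
  obtain ⟨S', hS'⟩ := cauchySeq_tendsto_of_complete hc
  refine ⟨S', fun x => ?_⟩
  have hGt : ∀ s, Tendsto (fun n => G n s) atTop (𝓝 (g s)) := by
    intro s
    rw [tendsto_iff_dist_tendsto_zero]
    refine squeeze_zero (fun _ => dist_nonneg) (fun n => ?_) hlim
    rw [dist_comm]
    exact hG n s
  have hmeas : AEStronglyMeasurable g (E.measure x) :=
    aestronglyMeasurable_of_tendsto_ae atTop (fun n => (hS n x).1.aestronglyMeasurable)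
      (ae_of_all _ hGt)
  have hint : Integrable g (E.measure x) := by
    have : Integrable (fun s => g s - G 0 s) (E.measure x) :=
      Integrable.of_bound (hmeas.sub (hS 0 x).1.aestronglyMeasurable) _ (ae_of_all _ (hG 0))
    exact (this.add (hS 0 x).1).congr (ae_of_all _ fun s => sub_add_cancel _ _)
  refine ⟨hint, ?_⟩
  have hi : Tendsto (fun n => ∫ s, G n s ∂(E.measure x)) atTop (𝓝 (∫ s, g s ∂(E.measure x))) := by
    refine tendsto_integral_of_dominated_convergence (fun s => |g s| + 1)
      (fun n => (hS n x).1.aestronglyMeasurable) (hint.abs.add (integrable_const _)) (fun n => ?_)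
      (ae_of_all _ hGt)
    refine ae_of_all _ fun s => ?_
    have h1 : (1 : ℝ) / (n + 1) ≤ 1 := by
      rw [div_le_one (by positivity)]
      linarith [(Nat.cast_nonneg n : (0 : ℝ) ≤ n)]
    have h2 := hG n s
    have h3 : |G n s| ≤ |g s| + |g s - G n s| := by
      have := abs_sub_abs_le_abs_sub (G n s) (g s)
      rw [abs_sub_comm] at this
      linarith
    rw [Real.norm_eq_abs]
    linarith
  have hin : Tendsto (fun n => ⟪x, S n x⟫_ℂ) atTop (𝓝 ⟪x, S' x⟫_ℂ) :=
    tendsto_const_nhds.inner (((ContinuousLinearMap.apply ℂ H x).continuous.tendsto S').comp hS')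
  refine tendsto_nhds_unique hin ?_
  simp only [fun n => (hS n x).2]
  exact (Complex.continuous_ofReal.tendsto _).comp hi

/-- Continuous functions vanishing at infinity are integrable. -/
theorem exists_isIntegral_of_continuous (E : SpectralFamily H) {g : ℝ → ℝ} (hc : Continuous g)
    (h0 : Tendsto g (cocompact ℝ) (𝓝 0)) : ∃ S, E.IsIntegral g S := by
  refine exists_isIntegral_of_forall_approx fun ε hε => ?_
  have hu : UniformContinuous g := hc.uniformContinuous_of_tendsto_cocompact h0
  obtain ⟨δ, hδ, hgδ⟩ := Metric.uniformContinuous_iff.1 hu ε hε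
  have h1 : ∀ᶠ s in cocompact ℝ, |g s| < ε := by
    have := h0.abs.eventually (gt_mem_nhds (by simpa using hε : |(0 : ℝ)| < ε))
    exact this
  rw [← Metric.cobounded_eq_cocompact] at h1
  obtain ⟨r, hr⟩ := (Metric.hasBasis_cobounded_compl_closedBall (0 : ℝ)).eventually_iff.1 h1
  -- The approximant is a step function on cells of length `d` below the modulus of continuity. It
  -- uses enough cells to cover [-r, r]; outside that interval |g| < ε already.
  obtain ⟨d, hd0, hdδ⟩ : ∃ d, 0 < d ∧ d < δ := ⟨δ / 2, by linarith, by linarith⟩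
  obtain ⟨m, hm⟩ := exists_nat_gt (r / d)
  have hm' : r < m * d := by rwa [div_lt_iff₀ hd0] at hm
  refine ⟨fun s => ∑ k ∈ Finset.Icc (-(m : ℤ)) m,
      g (k * d) * (Ioc ((k - 1) * d) (k * d)).indicator (fun _ => 1) s, _,
    IsIntegral.sum _ fun k _ => (isIntegral_indicator_Ioc (by nlinarith)).const_mul _,
    fun s => ?_⟩
  -- The half-open cells partition the line and are numbered by the ceiling of s / d, so at most one
  -- term of the sum is nonzero at `s`.
  have hmem : ∀ k : ℤ, s ∈ Ioc ((k - 1) * d) (k * d) ↔ k = ⌈s / d⌉ := by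
    intro k
    rw [eq_comm, Int.ceil_eq_iff, mem_Ioc, lt_div_iff₀ hd0, div_le_iff₀ hd0]
  beta_reduce
  by_cases hk : ⌈s / d⌉ ∈ Finset.Icc (-(m : ℤ)) m
  · rw [Finset.sum_eq_single_of_mem _ hk]
    · have h2 := (hmem _).2 rfl
      rw [indicator_of_mem h2, mul_one]
      refine (hgδ ?_).le
      rw [Real.dist_eq, abs_sub_comm, abs_of_nonneg (by linarith [h2.2])]
      linarith [h2.1]
    · intro k _ hne
      rw [indicator_of_notMem, mul_zero]
      rwa [hmem]
  · rw [Finset.sum_eq_zero, sub_zero]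
    · refine (hr.2 ?_).le
      simp only [mem_compl_iff, Metric.mem_closedBall, dist_zero_right, Real.norm_eq_abs, not_le]
      have h2 := (hmem _).2 rfl
      rw [Finset.mem_Icc, not_and_or, not_le, not_le] at hk
      rcases hk with hk | hk
      · have h3 : (⌈s / d⌉ : ℝ) ≤ -m := by exact_mod_cast hk.le
        have : s ≤ -m * d := h2.2.trans (by gcongr)
        rw [lt_abs]
        right
        linarith
      · have h3 : (m : ℝ) ≤ ⌈s / d⌉ - 1 := by
          have : (m : ℤ) ≤ ⌈s / d⌉ - 1 := by omega
          exact_mod_cast this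
        have : m * d ≤ (⌈s / d⌉ - 1) * d := by gcongr
        rw [lt_abs]
        left
        linarith [h2.1]
    · intro k hk'
      rw [indicator_of_notMem, mul_zero]
      rw [hmem]
      rintro rfl
      exact hk hk'

end SpectralFamily

/-! ### The null space of a positive operator as a spectral subspace. -/

namespace LinearPMap

variable {H : Type*} [NormedAddCommGroup H] [InnerProductSpace ℂ H] [CompleteSpace H]

theorem inner_map_eq_of_isSelfAdjoint {T : H →ₗ.[ℂ] H} (hT : IsSelfAdjoint T) (x y : T.domain) :
    ⟪T x, (y : H)⟫_ℂ = ⟪(x : H), T y⟫_ℂ := by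
  have h := adjoint_isFormalAdjoint (T := T) hT.dense_domain
  rw [isSelfAdjoint_def.1 hT] at h
  exact h x y

/-- The Cauchy-Schwarz inequality for the form `⟪x, T y⟫`, in the degenerate case. -/
theorem map_eq_zero_of_inner_eq_zero {T : H →ₗ.[ℂ] H} (hT : IsSelfAdjoint T)
    (hpos : ∀ x : T.domain, 0 ≤ (⟪(x : H), T x⟫_ℂ).re) {x : T.domain}
    (hx : ⟪(x : H), T x⟫_ℂ = 0) : T x = 0 := by
  have key : ∀ y : T.domain, ⟪T x, (y : H)⟫_ℂ = 0 := by
    intro y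
    set w := ⟪T x, (y : H)⟫_ℂ with hw
    have hw2 : ⟪(x : H), T y⟫_ℂ = w := by rw [hw, inner_map_eq_of_isSelfAdjoint hT]
    have hw3 : ⟪(y : H), T x⟫_ℂ = starRingEnd ℂ w := by rw [hw, inner_conj_symm]
    have h : ∀ n : ℝ, 0 ≤ (⟪(y : H), T y⟫_ℂ).re - 2 * n * ‖w‖ ^ 2 := by
      intro n
      -- The quadratic term in `n` is a multiple of ⟪x, T x⟫ = 0, so the form is affine in `n`;
      -- staying nonnegative for all `n` forces its slope -2‖w‖² to vanish.
      have h1 := hpos (y - ((n : ℂ) * w) • x)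
      rw [map_sub, map_smul] at h1
      simp only [Submodule.coe_sub, Submodule.coe_smul, inner_sub_left, inner_sub_right,
        inner_smul_left, inner_smul_right, hx, hw2, hw3, map_mul, Complex.conj_ofReal] at h1
      have h2 : (starRingEnd ℂ w) * w = ((‖w‖ ^ 2 : ℝ) : ℂ) := by
        rw [mul_comm, Complex.mul_conj, Complex.normSq_eq_norm_sq]
      rw [mul_assoc, mul_assoc, mul_comm w, h2] at h1
      simp only [Complex.sub_re, mul_zero, sub_zero, ← Complex.ofReal_mul, Complex.ofReal_re] at h1
      rw [h2, ← Complex.ofReal_mul, Complex.ofReal_re] at h1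
      linarith
    by_contra hne
    have hpos' : 0 < ‖w‖ ^ 2 := by positivity
    have := h (((⟪(y : H), T y⟫_ℂ).re + 1) / ‖w‖ ^ 2)
    rw [mul_assoc, div_mul_cancel₀ _ hpos'.ne'] at this
    have := hpos y
    linarith
  have hd := hT.dense_domain
  exact hd.eq_zero_of_inner_left ℂ fun y hy => key ⟨y, hy⟩

end LinearPMap

namespace SpectralFamily

variable {H : Type*} [NormedAddCommGroup H] [InnerProductSpace ℂ H] [CompleteSpace H]
variable (E : SpectralFamily H)

theorem proj_proj_eq_min (s t : ℝ) (x : H) : E.proj s (E.proj t x) = E.proj (min s t) x := by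
  rcases le_total s t with h | h
  · rw [E.proj_apply_proj h, min_eq_left h]
  · rw [E.proj_apply_proj' h, min_eq_right h]

theorem measure_proj (x : H) (t : ℝ) : E.measure (E.proj t x) = (E.measure x).restrict (Iic t) := by
  refine Measure.ext_of_Iic _ _ fun s => ?_
  rw [Measure.restrict_apply measurableSet_Iic, Iic_inter_Iic, measure_Iic, measure_Iic,
    proj_proj_eq_min]

theorem measure_sub_proj (x : H) (t : ℝ) :
    E.measure (x - E.proj t x) = (E.measure x).restrict (Ioi t) := by
  refine Measure.ext_of_Iic _ _ fun s => ?_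
  rw [Measure.restrict_apply measurableSet_Iic, measure_Iic, map_sub, proj_proj_eq_min,
    inter_comm, Ioi_inter_Iic]
  rcases le_total t s with h | h
  · rw [min_eq_right h, measure_Ioc _ _ h]
  · simp [h]

theorem integrable_id_of_sq {μ : Measure ℝ} [IsFiniteMeasure μ]
    (h : Integrable (fun s : ℝ => s ^ 2) μ) : Integrable (fun s : ℝ => s) μ := by
  refine (h.add (integrable_const 1)).mono' measurable_id.aestronglyMeasurable ?_
  refine ae_of_all _ fun s => ?_
  rw [Real.norm_eq_abs, abs_le]
  simp only [Pi.add_apply]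
  constructor <;> nlinarith [sq_nonneg (s - 1), sq_nonneg (s + 1)]

variable {E} {T : H →ₗ.[ℂ] H}

/-- For r < s < 0 a vector x in the range of P_s - P_r has its measure on (r, s]. It therefore lies
in the domain, and 0 ≤ ⟪x, T x⟫ ≤ s ‖x‖² forces x = 0. Hence P is constant below `s`, and its limit
at -∞ is 0. -/
theorem Resolves.proj_eq_zero (hE : E.Resolves T)
    (hpos : ∀ x : T.domain, 0 ≤ (⟪(x : H), T x⟫_ℂ).re) {s : ℝ} (hs : s < 0) : E.proj s = 0 := by
  ext y
  have key : ∀ r < s, E.proj r y = E.proj s y := by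
    intro r hr
    set z := E.proj s y with hz
    set x := z - E.proj r z with hx
    have hμ : E.measure x = (E.measure y).restrict (Ioc r s) := by
      rw [hx, measure_sub_proj, hz, measure_proj, Measure.restrict_restrict measurableSet_Ioi,
        Ioi_inter_Iic]
    have hae : ∀ᵐ t ∂(E.measure x), t ∈ Ioc r s := by
      rw [hμ]
      exact ae_restrict_mem measurableSet_Ioc
    have hsq : Integrable (fun t : ℝ => t ^ 2) (E.measure x) := by
      refine Integrable.of_bound (by fun_prop) (r ^ 2) ?_
      filter_upwards [hae] with t ht
      rw [Real.norm_eq_abs, abs_of_nonneg (sq_nonneg t)]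
      nlinarith [ht.1, ht.2]
    have h1 := hpos ⟨x, (hE.1 x).2 hsq⟩
    rw [hE.2, Complex.ofReal_re] at h1
    have h2 : ∫ t, t ∂(E.measure x) ≤ ∫ _, s ∂(E.measure x) := by
      refine integral_mono_ae (integrable_id_of_sq hsq) (integrable_const _) ?_
      filter_upwards [hae] with t ht using ht.2
    rw [integral_const, measureReal_univ, smul_eq_mul] at h2
    have h3 : ‖x‖ ^ 2 ≤ 0 := by
      by_contra h
      simp only at h1
      nlinarith
    have h4 : x = 0 := by
      have := sq_eq_zero_iff.1 (le_antisymm h3 (sq_nonneg _))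
      simpa using this
    rw [hx, sub_eq_zero, hz, E.proj_apply_proj hr.le] at h4
    exact h4.symm
  refine tendsto_nhds_unique (tendsto_const_nhds.congr' ?_) (E.tendsto_atBot y)
  filter_upwards [eventually_lt_atBot s] with r hr using (key r hr).symm

theorem ae_nonneg_of_proj_eq_zero (h : ∀ s < 0, E.proj s = 0) (x : H) :
    ∀ᵐ s ∂(E.measure x), 0 ≤ s := by
  have h1 : ∀ n : ℕ, ∀ᵐ s ∂(E.measure x), -(1 / ((n : ℝ) + 1)) < s := by
    intro n
    have h2 : -(1 / ((n : ℝ) + 1)) < 0 := by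
      rw [neg_lt_zero]
      positivity
    have : {s | ¬ -(1 / ((n : ℝ) + 1)) < s} = Iic (-(1 / ((n : ℝ) + 1))) := by
      ext
      simp
    rw [ae_iff, this, measure_Iic, h _ h2]
    simp
  filter_upwards [ae_all_iff.2 h1] with s hs
  have h3 := (tendsto_one_div_add_atTop_nhds_zero_nat (𝕜 := ℝ)).neg
  rw [neg_zero] at h3
  exact le_of_tendsto h3 (Eventually.of_forall fun n => (hs n).le)

theorem Resolves.ae_nonneg (hE : E.Resolves T)
    (hpos : ∀ x : T.domain, 0 ≤ (⟪(x : H), T x⟫_ℂ).re) (x : H) : ∀ᵐ s ∂(E.measure x), 0 ≤ s :=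
  ae_nonneg_of_proj_eq_zero (fun _ => hE.proj_eq_zero hpos) x

/-- Both sides say that μ_x is carried by {0}. If T x = 0, then ∫ s dμ_x = 0 with s ≥ 0 almost
everywhere. Conversely, a measure at 0 puts `x` in the domain with ⟪x, T x⟫ = 0, and Cauchy-Schwarz
for the form gives T x = 0. -/
theorem Resolves.mem_nullSpace_iff (hE : E.Resolves T) (hT : IsSelfAdjoint T)
    (hpos : ∀ x : T.domain, 0 ≤ (⟪(x : H), T x⟫_ℂ).re) (x : H) :
    x ∈ T.nullSpace ↔ E.proj 0 x = x := by
  have hnn := hE.ae_nonneg hpos x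
  rw [LinearPMap.mem_nullSpace]
  constructor
  · rintro ⟨hx, hTx⟩
    have h1 := hE.2 ⟨x, hx⟩
    rw [hTx, inner_zero_right] at h1
    have h2 : ∫ s, s ∂(E.measure x) = 0 := by exact_mod_cast h1.symm
    rw [integral_eq_zero_iff_of_nonneg_ae hnn (integrable_id_of_sq ((hE.1 x).1 hx))] at h2
    have h3 : E.measure (x - E.proj 0 x) univ = 0 := by
      rw [measure_sub_proj, Measure.restrict_apply_univ, ← nonpos_iff_eq_zero]
      refine (measure_mono ?_).trans_eq (ae_iff.1 h2)
      intro s (hs : 0 < s)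
      exact hs.ne'
    rw [SpectralFamily.measure_univ, ENNReal.ofReal_eq_zero] at h3
    have h4 := sq_eq_zero_iff.1 (le_antisymm h3 (sq_nonneg _))
    rw [norm_eq_zero, sub_eq_zero] at h4
    exact h4.symm
  · intro hx
    have hae : ∀ᵐ s ∂(E.measure x), s = 0 := by
      have : ∀ᵐ s ∂(E.measure x), s ∈ Iic 0 := by
        rw [← hx, measure_proj]
        exact ae_restrict_mem measurableSet_Iic
      filter_upwards [hnn, this] with s h1 h2 using le_antisymm h2 h1
    have hsq : Integrable (fun t : ℝ => t ^ 2) (E.measure x) := by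
      refine (integrable_zero ℝ ℝ (E.measure x)).congr ?_
      filter_upwards [hae] with s hs
      simp [hs]
    refine ⟨(hE.1 x).2 hsq, LinearPMap.map_eq_zero_of_inner_eq_zero hT hpos ?_⟩
    rw [hE.2, integral_eq_zero_of_ae hae]
    simp

theorem Resolves.nullProj_eq (hE : E.Resolves T) (hT : IsSelfAdjoint T)
    (hpos : ∀ x : T.domain, 0 ≤ (⟪(x : H), T x⟫_ℂ).re) : T.nullProj = E.proj 0 := by
  have hcl : T.nullSpace.topologicalClosure = T.nullSpace :=
    IsClosed.submodule_topologicalClosure_eq (LinearPMap.isClosed_nullSpace hT)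
  ext x
  refine Submodule.eq_starProjection_of_mem_orthogonal ?_ ?_
  · rw [hcl, hE.mem_nullSpace_iff hT hpos, E.proj_apply_proj le_rfl]
  · rw [hcl, Submodule.mem_orthogonal]
    intro u hu
    rw [hE.mem_nullSpace_iff hT hpos] at hu
    rw [← hu, E.inner_proj_apply, map_sub, E.proj_apply_proj le_rfl, sub_self, inner_zero_right]

end SpectralFamily

/-! ### The resolvent (1 + T)⁻¹. -/

namespace LinearPMap

variable {H : Type*} [NormedAddCommGroup H] [InnerProductSpace ℂ H] [CompleteSpace H]

theorem inner_self_im_eq_zero {T : H →ₗ.[ℂ] H} (hT : IsSelfAdjoint T) (x : T.domain) :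
    (⟪(x : H), T x⟫_ℂ).im = 0 := by
  rw [← Complex.conj_eq_iff_im, inner_conj_symm, inner_map_eq_of_isSelfAdjoint hT]

/-- The resolvent `(1 + T)⁻¹` of a positive self-adjoint operator. -/
theorem exists_resolvent {T : H →ₗ.[ℂ] H} (hT : IsSelfAdjoint T)
    (hpos : ∀ x : T.domain, 0 ≤ (⟪(x : H), T x⟫_ℂ).re) :
    ∃ R : H →L[ℂ] H, (∀ y, ∃ h : R y ∈ T.domain, T ⟨R y, h⟩ = y - R y) ∧
      ∀ x : T.domain, R (x + T x) = x := by
  have : CompleteSpace T.graph := hT.isClosed.completeSpace_coe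
  -- Sending (x, T x) to x + T x on the complete graph makes 1 + T a bounded map. Positivity gives
  -- ‖x + T x‖² ≥ ‖x‖² + ‖T x‖², so this map is injective with closed range.
  let Φ : T.graph →L[ℂ] H :=
    ((ContinuousLinearMap.fst ℂ H H) + (ContinuousLinearMap.snd ℂ H H)).comp T.graph.subtypeL
  have hΦ : ∀ z : T.graph, Φ z = (z : H × H).1 + (z : H × H).2 := fun z => rfl
  have hmem : ∀ z : T.graph, ∃ h : (z : H × H).1 ∈ T.domain, T ⟨_, h⟩ = (z : H × H).2 := by
    intro z
    obtain ⟨x, h1, h2⟩ := (mem_graph_iff T).1 z.2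
    refine ⟨h1 ▸ x.2, ?_⟩
    rw [← h2]
    congr 1
    exact Subtype.ext h1.symm
  have hbound : ∀ z : T.graph, ‖z‖ ≤ 1 * ‖Φ z‖ := by
    intro z
    obtain ⟨h1, h2⟩ := hmem z
    have h3 := @norm_add_sq ℂ _ _ _ _ (z : H × H).1 (z : H × H).2
    simp only [RCLike.re_to_complex] at h3
    have h4 := hpos ⟨_, h1⟩
    rw [h2] at h4
    rw [one_mul, hΦ]
    change ‖(z : H × H)‖ ≤ _
    rw [Prod.norm_def, max_le_iff]
    constructor
    · refine abs_le_of_sq_le_sq' ?_ (norm_nonneg _) |>.2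
      simp only at h3 h4
      nlinarith [sq_nonneg ‖(z : H × H).2‖]
    · refine abs_le_of_sq_le_sq' ?_ (norm_nonneg _) |>.2
      simp only at h3 h4
      nlinarith [sq_nonneg ‖(z : H × H).1‖]
  have hanti : AntilipschitzWith 1 Φ := AddMonoidHomClass.antilipschitz_of_bound Φ hbound
  have hclosed : _root_.IsClosed (range Φ) := hanti.isClosed_range Φ.uniformContinuous
  have hclosed' : _root_.IsClosed ((Φ : T.graph →ₗ[ℂ] H).range : Set H) := by
    simpa [LinearMap.coe_range] using hclosed
  have hker : (Φ : T.graph →ₗ[ℂ] H).ker = ⊥ := LinearMap.ker_eq_bot.2 hanti.injective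
  have hrange : (Φ : T.graph →ₗ[ℂ] H).range = ⊤ := by
    rw [← hclosed'.submodule_topologicalClosure_eq, Submodule.topologicalClosure_eq_top_iff,
      eq_bot_iff]
    -- A vector `z` orthogonal to the range satisfies T* z = -z. As T* = T, positivity gives -‖z‖² ≥
    -- 0.
    intro z hz
    rw [Submodule.mem_orthogonal'] at hz
    have hz' : ∀ x : T.domain, ⟪-z, (x : H)⟫_ℂ = ⟪z, T x⟫_ℂ := by
      intro x
      have := hz _ (LinearMap.mem_range_self (Φ : T.graph →ₗ[ℂ] H) ⟨_, T.mem_graph x⟩)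
      rw [ContinuousLinearMap.coe_coe, hΦ, inner_add_right] at this
      rw [inner_neg_left]
      exact neg_eq_of_add_eq_zero_right this
    have hd : z ∈ T.adjoint.domain := mem_adjoint_domain_of_exists z ⟨-z, hz'⟩
    have hv := adjoint_apply_eq hT.dense_domain ⟨z, hd⟩ hz'
    obtain ⟨hd', hv'⟩ : ∃ h : z ∈ T.domain, T ⟨z, h⟩ = -z := by
      rw [isSelfAdjoint_def] at hT
      generalize hS : T.adjoint = S at hd hv
      rw [hT] at hS
      subst hS
      exact ⟨hd, hv⟩
    have h1 := hpos ⟨z, hd'⟩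
    rw [hv', inner_neg_right, inner_self_eq_norm_sq_to_K, Complex.neg_re] at h1
    have h2 : ‖z‖ ^ 2 ≤ 0 := by
      have : (((‖z‖ : ℝ) : ℂ) ^ 2).re = ‖z‖ ^ 2 := by norm_cast
      simp only [Complex.coe_algebraMap] at h1
      linarith
    have := sq_eq_zero_iff.1 (le_antisymm h2 (sq_nonneg _))
    simpa using this
  let e := ContinuousLinearEquiv.ofBijective Φ hker hrange
  have he : ∀ z, e z = Φ z := fun z => rfl
  refine ⟨(ContinuousLinearMap.fst ℂ H H).comp (T.graph.subtypeL.comp (e.symm : H →L[ℂ] T.graph)),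
    fun y => ?_, fun x => ?_⟩
  · obtain ⟨h1, h2⟩ := hmem (e.symm y)
    refine ⟨h1, h2.trans ?_⟩
    have h3 : Φ (e.symm y) = y := e.apply_symm_apply y
    rw [hΦ] at h3
    exact eq_sub_of_add_eq' h3
  · have h1 : e ⟨_, T.mem_graph x⟩ = x + T x := rfl
    rw [← h1]
    simp

variable {T : H →ₗ.[ℂ] H} {R : H →L[ℂ] H}

/-- Writing y = R y + T (R y) gives ⟪y, R y⟫ = ‖R y‖² + ⟪R y, T (R y)⟫, a sum of nonnegative terms.
-/
theorem resolvent_nonneg (hT : IsSelfAdjoint T) (hpos : ∀ x : T.domain, 0 ≤ (⟪(x : H), T x⟫_ℂ).re)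
    (hR : ∀ y, ∃ h : R y ∈ T.domain, T ⟨R y, h⟩ = y - R y) : 0 ≤ R := by
  rw [ContinuousLinearMap.nonneg_iff_isPositive]
  choose hd hv using hR
  refine ContinuousLinearMap.isPositive_of_inner_eq
    (q := fun y => ‖R y‖ ^ 2 + (⟪R y, T ⟨R y, hd y⟩⟫_ℂ).re) (fun y => ?_) fun y => ?_
  · have h1 : y = R y + T ⟨R y, hd y⟩ := by rw [hv]; abel
    have h2 : ⟪T ⟨R y, hd y⟩, R y⟫_ℂ = ((⟪R y, T ⟨R y, hd y⟩⟫_ℂ).re : ℂ) := by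
      rw [inner_map_eq_of_isSelfAdjoint hT ⟨R y, hd y⟩ ⟨R y, hd y⟩]
      exact Complex.ext rfl (inner_self_im_eq_zero hT ⟨R y, hd y⟩)
    calc ⟪y, R y⟫_ℂ = ⟪R y + T ⟨R y, hd y⟩, R y⟫_ℂ := by rw [← h1]
      _ = _ := by
        rw [inner_add_left, h2, inner_self_eq_norm_sq_to_K]
        push_cast
        rfl
  · have := hpos ⟨R y, hd y⟩
    positivity

theorem resolvent_le_one (hT : IsSelfAdjoint T) (hpos : ∀ x : T.domain, 0 ≤ (⟪(x : H), T x⟫_ℂ).re)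
    (hR : ∀ y, ∃ h : R y ∈ T.domain, T ⟨R y, h⟩ = y - R y) : R ≤ 1 := by
  rw [ContinuousLinearMap.le_def]
  choose hd hv using hR
  refine ContinuousLinearMap.isPositive_of_inner_eq
    (q := fun y => (⟪R y, T ⟨R y, hd y⟩⟫_ℂ).re + ‖T ⟨R y, hd y⟩‖ ^ 2) (fun y => ?_) fun y => ?_
  · have h1 : y = R y + T ⟨R y, hd y⟩ := by rw [hv]; abel
    have h2 : ⟪R y, T ⟨R y, hd y⟩⟫_ℂ = ((⟪R y, T ⟨R y, hd y⟩⟫_ℂ).re : ℂ) :=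
      Complex.ext rfl (inner_self_im_eq_zero hT ⟨R y, hd y⟩)
    have h3 : (1 - R) y = T ⟨R y, hd y⟩ := by rw [hv]; rfl
    calc ⟪y, (1 - R) y⟫_ℂ = ⟪R y + T ⟨R y, hd y⟩, T ⟨R y, hd y⟩⟫_ℂ := by rw [← h1, h3]
      _ = _ := by
        rw [inner_add_left, inner_self_eq_norm_sq_to_K, Complex.ofReal_add, ← h2]
        push_cast
        rfl
  · have := hpos ⟨R y, hd y⟩
    positivity

end LinearPMap

/-! ### Spectral subspaces of R⁻¹ - 1, cut out from `R` at the level 1 / (1 + s). -/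

namespace ContinuousLinearMap

variable {H : Type*} [NormedAddCommGroup H] [InnerProductSpace ℂ H] [CompleteSpace H]

theorem IsPositive.apply_eq_zero {D : H →L[ℂ] H} (hD : D.IsPositive) {x : H}
    (hx : (⟪x, D x⟫_ℂ).re ≤ 0) : D x = 0 := by
  have h := hD.norm_apply_sq_le (K := ‖D‖) (fun y => ?_) x
  · have h2 : ‖D x‖ ^ 2 ≤ 0 := h.trans (mul_nonpos_of_nonneg_of_nonpos (norm_nonneg _) hx)
    have := sq_eq_zero_iff.1 (le_antisymm h2 (sq_nonneg _))
    simpa using this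
  · calc (⟪y, D y⟫_ℂ).re ≤ ‖y‖ * ‖D y‖ := (Complex.re_le_norm _).trans (norm_inner_le_norm _ _)
      _ ≤ ‖y‖ * (‖D‖ * ‖y‖) := by gcongr; exact D.le_opNorm y
      _ = ‖D‖ * ‖y‖ ^ 2 := by ring

theorem starProjection_ker_commute {N K : H →L[ℂ] H} (hKN : Commute K N) (hK : IsSelfAdjoint K)
    (x : H) : N.ker.starProjection (K x) = K (N.ker.starProjection x) := by
  have hker : ∀ u ∈ N.ker, K u ∈ N.ker := by
    intro u hu
    have : (K * N) u = (N * K) u := by rw [hKN.eq]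
    rw [mul_apply_eq_comp, mul_apply_eq_comp, show N u = 0 from hu, map_zero] at this
    exact this.symm
  refine Submodule.eq_starProjection_of_mem_orthogonal
    (hker _ (Submodule.starProjection_apply_mem _ _)) ?_
  rw [Submodule.mem_orthogonal]
  intro u hu
  rw [← map_sub, ← adjoint_inner_left, isSelfAdjoint_iff'.1 hK]
  exact Submodule.inner_right_of_mem_orthogonal (hker u hu)
    (Submodule.sub_starProjection_mem_orthogonal x)

/-- The negative part of `(1 + s) R - 1`. -/
noncomputable def negCut (R : H →L[ℂ] H) (s : ℝ) : H →L[ℂ] H :=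
  cfc (fun r : ℝ => max (1 - (1 + s) * r) 0) R

/-- The positive part of `(1 + s) R - 1`. -/
noncomputable def posCut (R : H →L[ℂ] H) (s : ℝ) : H →L[ℂ] H :=
  cfc (fun r : ℝ => max ((1 + s) * r - 1) 0) R

variable {R : H →L[ℂ] H}

theorem negCut_nonneg (s : ℝ) : 0 ≤ negCut R s := cfc_nonneg fun _ _ => le_max_right _ _

theorem posCut_nonneg (s : ℝ) : 0 ≤ posCut R s := cfc_nonneg fun _ _ => le_max_right _ _

theorem posCut_sub_negCut (h0 : 0 ≤ R) (s : ℝ) :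
    posCut R s - negCut R s = ((1 + s : ℝ) : ℂ) • R - 1 := by
  have hR : IsSelfAdjoint R := .of_nonneg h0
  rw [posCut, negCut, ← cfc_sub (fun r : ℝ => max ((1 + s) * r - 1) 0)
    (fun r : ℝ => max (1 - (1 + s) * r) 0) R (by fun_prop) (by fun_prop)]
  have h1 : (fun r : ℝ => max ((1 + s) * r - 1) 0 - max (1 - (1 + s) * r) 0) =
      fun r : ℝ => (1 + s) * r - 1 := by
    ext r
    rcases le_total ((1 + s) * r) 1 with h | h
    · rw [max_eq_right (by linarith), max_eq_left (by linarith)]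
      ring
    · rw [max_eq_left (by linarith), max_eq_right (by linarith)]
      ring
  rw [h1, cfc_sub (fun r : ℝ => (1 + s) * r) (fun _ => 1) R, cfc_const_mul_id _ R,
    cfc_const_one ℝ R]
  rfl

theorem posCut_apply (h0 : 0 ≤ R) (s : ℝ) (x : H) :
    posCut R s x = ((1 + s : ℝ) : ℂ) • R x - x + negCut R s x := by
  have := congrArg (fun A : H →L[ℂ] H => A x) (posCut_sub_negCut h0 s)
  simp only [sub_apply, smul_apply, one_apply_eq_self] at this
  rw [← this]
  abel

theorem negCut_mul_posCut (s : ℝ) : negCut R s * posCut R s = 0 := by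
  rw [posCut, negCut, ← cfc_mul (fun r : ℝ => max (1 - (1 + s) * r) 0)
    (fun r : ℝ => max ((1 + s) * r - 1) 0) R (by fun_prop) (by fun_prop)]
  have h1 : (fun r : ℝ => max (1 - (1 + s) * r) 0 * max ((1 + s) * r - 1) 0) = fun _ => 0 := by
    ext r
    rcases le_total ((1 + s) * r) 1 with h | h
    · rw [max_eq_right (a := (1 + s) * r - 1) (by linarith), mul_zero]
    · rw [max_eq_right (a := 1 - (1 + s) * r) (by linarith), zero_mul]
  rw [h1, cfc_const_zero]

theorem negCut_anti (h0 : 0 ≤ R) {s t : ℝ} (h : s ≤ t) : negCut R t ≤ negCut R s := by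
  refine cfc_mono (fun r hr => ?_) (by fun_prop) (by fun_prop)
  have : 0 ≤ r := spectrum_nonneg_of_nonneg h0 hr
  gcongr

/-- The negative parts decrease in `s`, so ⟪x, N_t x⟫ is squeezed between 0 and ⟪x, N_s x⟫ = 0; a
positive operator with vanishing form at `x` kills `x`. -/
theorem ker_negCut_mono (h0 : 0 ≤ R) : Monotone fun s => (negCut R s).ker := by
  intro s t hst x hx
  have hx' : negCut R s x = 0 := hx
  refine ((nonneg_iff_isPositive _).1 (negCut_nonneg t)).apply_eq_zero ?_
  have := ((le_def _ _).1 (negCut_anti h0 hst)).re_inner_nonneg_right x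
  rw [sub_apply, hx', zero_sub, inner_neg_right] at this
  simpa using this

theorem norm_negCut_le (h0 : 0 ≤ R) {s : ℝ} (hs : 0 ≤ s) : ‖negCut R s‖ ≤ 1 := by
  refine norm_cfc_le zero_le_one fun r hr => ?_
  have : 0 ≤ r := spectrum_nonneg_of_nonneg h0 hr
  rw [Real.norm_eq_abs, abs_of_nonneg (le_max_right _ _), max_le_iff]
  constructor <;> nlinarith

theorem spectrum_le_one (h0 : 0 ≤ R) (h1 : R ≤ 1) {r : ℝ} (hr : r ∈ spectrum ℝ R) : r ≤ 1 :=
  (CFC.le_one_iff (R := ℝ) R (.of_nonneg h0)).1 h1 r hr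

theorem norm_negCut_sub_le (h0 : 0 ≤ R) (h1 : R ≤ 1) (s t : ℝ) :
    ‖negCut R s - negCut R t‖ ≤ |s - t| := by
  rw [negCut, negCut, ← cfc_sub (fun r : ℝ => max (1 - (1 + s) * r) 0)
    (fun r : ℝ => max (1 - (1 + t) * r) 0) R (by fun_prop) (by fun_prop)]
  refine norm_cfc_le (abs_nonneg _) fun r hr => ?_
  have h2 : 0 ≤ r := spectrum_nonneg_of_nonneg h0 hr
  have h3 : r ≤ 1 := spectrum_le_one h0 h1 hr
  rw [Real.norm_eq_abs]
  refine (abs_max_sub_max_le_abs _ _ _).trans ?_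
  have : 1 - (1 + s) * r - (1 - (1 + t) * r) = -((s - t) * r) := by ring
  rw [this, abs_neg, abs_mul, abs_of_nonneg h2]
  exact mul_le_of_le_one_right (abs_nonneg _) h3

theorem ker_negCut_of_neg (h0 : 0 ≤ R) (h1 : R ≤ 1) {s : ℝ} (hs : s < 0) :
    (negCut R s).ker = ⊥ := by
  rw [eq_bot_iff]
  intro x hx
  have hx' : negCut R s x = 0 := hx
  have hδ : 0 < min 1 (-s) := lt_min one_pos (by linarith)
  -- For r in [0, 1] the function 1 - (1 + s) r is at least -s if s ≥ -1, and at least 1 otherwise.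
  have hle : algebraMap ℝ (H →L[ℂ] H) (min 1 (-s)) ≤ negCut R s := by
    refine algebraMap_le_cfc _ _ _ (fun r hr => ?_) (by fun_prop) (.of_nonneg h0)
    have h2 : 0 ≤ r := spectrum_nonneg_of_nonneg h0 hr
    have h3 : r ≤ 1 := spectrum_le_one h0 h1 hr
    refine le_max_of_le_left ?_
    have h4 := min_le_left 1 (-s)
    have h5 := min_le_right 1 (-s)
    nlinarith
  have h2 := ((le_def _ _).1 hle).re_inner_nonneg_right x
  have h3 : (algebraMap ℝ (H →L[ℂ] H) (min 1 (-s))) x = ((min 1 (-s) : ℝ) : ℂ) • x := by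
    rw [Algebra.algebraMap_eq_smul_one]
    rfl
  rw [sub_apply, hx', zero_sub, inner_neg_right, h3, inner_smul_right,
    inner_self_eq_norm_sq_to_K] at h2
  have h4 : min 1 (-s) * ‖x‖ ^ 2 ≤ 0 := by
    rw [← neg_nonneg]
    refine h2.trans_eq ?_
    simp only [map_neg, Complex.coe_algebraMap, RCLike.re_to_complex]
    norm_cast
  have h5 : ‖x‖ ^ 2 ≤ 0 := by
    by_contra h
    nlinarith
  have := sq_eq_zero_iff.1 (le_antisymm h5 (sq_nonneg _))
  simpa using this

/-- Right continuity of the kernels, which holds because `negCut R s` is norm continuous in `s`. -/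
theorem ker_negCut_eq_iInf (h0 : 0 ≤ R) (h1 : R ≤ 1) (s : ℝ) :
    (negCut R s).ker = ⨅ t : Ioi s, (negCut R t).ker := by
  refine le_antisymm (le_iInf fun t => ker_negCut_mono h0 t.2.le) fun x hx => ?_
  rw [Submodule.mem_iInf] at hx
  have hlim : Tendsto (fun t => negCut R t) (𝓝[>] s) (𝓝 (negCut R s)) := by
    refine tendsto_nhdsWithin_of_tendsto_nhds ?_
    rw [tendsto_iff_norm_sub_tendsto_zero]
    refine squeeze_zero (fun _ => norm_nonneg _) (fun t => norm_negCut_sub_le h0 h1 t s) ?_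
    have : Continuous fun t => |t - s| := by fun_prop
    simpa using this.tendsto s
  have hlim' := ((ContinuousLinearMap.apply ℂ H x).continuous.tendsto _).comp hlim
  refine tendsto_nhds_unique hlim' (tendsto_const_nhds.congr' ?_)
  filter_upwards [self_mem_nhdsWithin] with t ht
  exact (hx ⟨t, ht⟩).symm

theorem posCut_mem_ker_negCut (s : ℝ) (x : H) : posCut R s x ∈ (negCut R s).ker := by
  change (negCut R s * posCut R s) x = 0
  rw [negCut_mul_posCut, zero_apply]

/-- The vectors (1 + s)⁻¹ `posCut R s x` lie in the kernels, because the two cuts multiply to 0, and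
they differ from R x by (1 + s)⁻¹ (`negCut R s x` - x), which tends to 0. So the closure contains
the dense range of `R`. -/
theorem top_le_closure_iSup_ker_negCut (h0 : 0 ≤ R) (hd : DenseRange R) :
    ⊤ ≤ (⨆ s, (negCut R s).ker).topologicalClosure := by
  intro y _
  have hsub : range R ⊆ closure ((⨆ s, (negCut R s).ker : Submodule ℂ H) : Set H) := by
    rintro _ ⟨x, rfl⟩
    have h1 : Tendsto (fun s : ℝ => ((1 + s : ℝ) : ℂ)⁻¹ • posCut R s x) atTop (𝓝 (R x)) := by
      have h2 : Tendsto (fun s : ℝ => (1 + s)⁻¹ * (2 * ‖x‖)) atTop (𝓝 0) := by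
        have := (tendsto_inv_atTop_zero.comp
          (tendsto_atTop_add_const_left atTop (1 : ℝ) tendsto_id)).mul_const (2 * ‖x‖)
        simpa using this
      rw [tendsto_iff_norm_sub_tendsto_zero]
      refine squeeze_zero' (Eventually.of_forall fun _ => norm_nonneg _) ?_ h2
      filter_upwards [eventually_ge_atTop 0] with s hs
      have h3 : ((1 + s : ℝ) : ℂ) ≠ 0 := by
        rw [Complex.ofReal_ne_zero]
        positivity
      have h4 : ((1 + s : ℝ) : ℂ)⁻¹ • posCut R s x - R x =
          ((1 + s : ℝ) : ℂ)⁻¹ • (negCut R s x - x) := by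
        rw [posCut_apply h0]
        simp only [smul_add, smul_sub, inv_smul_smul₀ h3]
        abel
      rw [h4, norm_smul, norm_inv, Complex.norm_real, Real.norm_eq_abs,
        abs_of_nonneg (by positivity)]
      gcongr
      refine (norm_sub_le _ _).trans ?_
      have := (negCut R s).le_of_opNorm_le (norm_negCut_le h0 hs) x
      linarith
    refine mem_closure_of_tendsto h1 (Eventually.of_forall fun s => ?_)
    exact Submodule.smul_mem _ _ (Submodule.mem_iSup_of_mem s (posCut_mem_ker_negCut s x))
  exact closure_minimal hsub isClosed_closure (hd y)

/-- On the kernel of the negative part of `(1 + s) R - 1` the operator `R` is invertible. -/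
theorem exists_mul_eq_one_sub_negCut (h0 : 0 ≤ R) {s : ℝ} (hs : 0 ≤ s) :
    ∃ K : H →L[ℂ] H, R * K = 1 - negCut R s := by
  have hR : IsSelfAdjoint R := .of_nonneg h0
  have hc : Continuous fun r : ℝ => (max r (1 + s)⁻¹)⁻¹ := by
    refine Continuous.inv₀ (by fun_prop) fun r => ?_
    have : 0 < (1 + s)⁻¹ := by positivity
    exact (lt_max_of_lt_right this).ne'
  -- The inverse of `r` truncated at the cut: r / max(r, 1 / (1 + s)) = min((1 + s) r, 1) = 1 -
  -- max(1 - (1 + s) r, 0) for r ≥ 0.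
  refine ⟨cfc (fun r : ℝ => (max r (1 + s)⁻¹)⁻¹) R, ?_⟩
  rw [negCut, ← cfc_const_one ℝ R,
    ← cfc_sub (fun _ => 1) (fun r : ℝ => max (1 - (1 + s) * r) 0) R (by fun_prop) (by fun_prop)]
  nth_rw 1 [← cfc_id ℝ R]
  rw [← cfc_mul _ _ R (by fun_prop) hc.continuousOn]
  refine cfc_congr fun r hr => ?_
  have h2 : 0 ≤ r := spectrum_nonneg_of_nonneg h0 hr
  have h3 : (0 : ℝ) < 1 + s := by positivity
  have h4 : (1 + s) * (1 + s)⁻¹ = 1 := mul_inv_cancel₀ h3.ne'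
  simp only [id_eq]
  rcases le_total r (1 + s)⁻¹ with h | h
  · have : (1 + s) * r ≤ 1 := by linarith [mul_le_mul_of_nonneg_left h h3.le]
    rw [max_eq_right h, max_eq_left (by linarith), inv_inv]
    ring
  · have h5 : 1 ≤ (1 + s) * r := by linarith [mul_le_mul_of_nonneg_left h h3.le]
    have h6 : r ≠ 0 := by
      rintro rfl
      linarith
    rw [max_eq_left h, max_eq_right (by linarith), mul_inv_cancel₀ h6, sub_zero]

end ContinuousLinearMap

/-- Split [s, t] into n equal pieces: the increments of `m` telescope, leaving the bound (t - s)(m t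
- m s) / n. -/
theorem eq_of_abs_sub_le_mul_sub {D m : ℝ → ℝ}
    (h : ∀ s t, s ≤ t → |D t - D s| ≤ (t - s) * (m t - m s)) {s t : ℝ} (hst : s ≤ t) :
    D t = D s := by
  have key : ∀ d : ℝ, 0 ≤ d → ∀ k : ℕ, |D (s + k * d) - D s| ≤ d * (m (s + k * d) - m s) := by
    intro d hd k
    induction k with
    | zero => simp
    | succ k ih =>
      have h1 := h (s + k * d) (s + (k + 1 : ℕ) * d) (by push_cast; linarith)
      have h2 : s + (k + 1 : ℕ) * d - (s + k * d) = d := by push_cast; ring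
      rw [h2] at h1
      have h3 := abs_sub_le (D (s + (k + 1 : ℕ) * d)) (D (s + k * d)) (D s)
      linarith
  have hn : ∀ n : ℕ, |D t - D s| ≤ 1 / ((n : ℝ) + 1) * ((t - s) * (m t - m s)) := by
    intro n
    have h1 := key ((t - s) / (n + 1)) (div_nonneg (by linarith) (by positivity)) (n + 1)
    have h2 : s + (n + 1 : ℕ) * ((t - s) / (n + 1)) = t := by
      have : (n : ℝ) + 1 ≠ 0 := by positivity
      push_cast
      field_simp
      ring
    rw [h2] at h1
    refine h1.trans_eq (by ring)
  have hlim := (tendsto_one_div_add_atTop_nhds_zero_nat (𝕜 := ℝ)).mul_const ((t - s) * (m t - m s))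
  rw [zero_mul] at hlim
  have := ge_of_tendsto' hlim hn
  exact sub_eq_zero.1 (abs_nonpos_iff.1 this)

/-- Orthogonal complements turn the decreasing intersection into an increasing union, for which
strong convergence of projections is known. -/
theorem tendsto_starProjection_nhdsGT {H : Type*} [NormedAddCommGroup H] [InnerProductSpace ℂ H]
    [CompleteSpace H] {V : ℝ → Submodule ℂ H} [∀ t, (V t).HasOrthogonalProjection]
    (hV : Monotone V) {s : ℝ} (hs : V s = ⨅ t : Ioi s, V t) (x : H) :
    Tendsto (fun t => (V t).starProjection x) (𝓝[>] s) (𝓝 ((V s).starProjection x)) := by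
  have hU : Monotone fun t : (Ioi s)ᵒᵈ => (V (OrderDual.ofDual t : Ioi s))ᗮ := fun t t' htt' =>
    Submodule.orthogonal_le (hV (Subtype.coe_le_coe.2 htt'))
  have h2 := Submodule.starProjection_tendsto_closure_iSup _ hU x
  have h3 : (⨆ t : (Ioi s)ᵒᵈ, (V (OrderDual.ofDual t : Ioi s))ᗮ).topologicalClosure = (V s)ᗮ := by
    rw [← Submodule.orthogonal_orthogonal_eq_closure, ← Submodule.iInf_orthogonal, hs]
    congr 1
    exact iInf_congr fun t => Submodule.orthogonal_orthogonal _
  have h4 : Tendsto (fun t : Ioi s => (V t)ᗮ.starProjection x) atBot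
      (𝓝 ((V s)ᗮ.starProjection x)) := by
    simp only [h3] at h2
    exact h2
  have h4' : Tendsto (fun t => (V t)ᗮ.starProjection x) (𝓝[>] s)
      (𝓝 ((V s)ᗮ.starProjection x)) :=
    (tendsto_comp_coe_Ioi_atBot (f := fun t => (V t)ᗮ.starProjection x)).1 h4
  have h5 := (tendsto_const_nhds (x := x)).sub h4'
  simpa [Submodule.starProjection_orthogonal] using h5

open ContinuousLinearMap in
/-- The spectral family of `R⁻¹ - 1`, for an injective operator `0 ≤ R ≤ 1`. -/
noncomputable def SpectralFamily.ofContraction {H : Type*} [NormedAddCommGroup H]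
    [InnerProductSpace ℂ H] [CompleteSpace H] (R : H →L[ℂ] H) (h0 : 0 ≤ R) (h1 : R ≤ 1)
    (hd : DenseRange R) : SpectralFamily H where
  proj s := (negCut R s).ker.starProjection
  isStarProjection _ := isStarProjection_starProjection
  proj_mul_proj s t h := by
    ext x
    rw [mul_apply_eq_comp, Submodule.starProjection_apply,
      Submodule.starProjection_apply (negCut R s).ker,
      Submodule.orthogonalProjectionOnto_starProjection_of_le (ker_negCut_mono h0 h)]
  right_continuous s x := tendsto_starProjection_nhdsGT (ker_negCut_mono h0)
    (ker_negCut_eq_iInf h0 h1 s) x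
  tendsto_atBot x := by
    refine tendsto_const_nhds.congr' ?_
    filter_upwards [eventually_lt_atBot 0] with s hs
    exact ((Submodule.mem_bot ℂ).1 ((ker_negCut_of_neg h0 h1 hs).le
      (Submodule.starProjection_apply_mem (negCut R s).ker x))).symm
  tendsto_atTop x := Submodule.starProjection_tendsto_self _ (ker_negCut_mono h0) x
    (top_le_closure_iSup_ker_negCut h0 hd)

/-! ### Spectral measures of `R x` and the range of `R`. -/

namespace SpectralFamily

variable {H : Type*} [NormedAddCommGroup H] [InnerProductSpace ℂ H] [CompleteSpace H]
variable {R : H →L[ℂ] H} (h0 : 0 ≤ R) (h1 : R ≤ 1) (hd : DenseRange R)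

open ContinuousLinearMap

theorem ofContraction_proj_of_neg {s : ℝ} (hs : s < 0) : (ofContraction R h0 h1 hd).proj s = 0 := by
  ext x
  exact (Submodule.mem_bot ℂ).1 ((ker_negCut_of_neg h0 h1 hs).le
    (Submodule.starProjection_apply_mem (negCut R s).ker x))

theorem ofContraction_proj_commute {K : H →L[ℂ] H} (hK : IsSelfAdjoint K) {s : ℝ}
    (hKN : Commute K (negCut R s)) (x : H) :
    (ofContraction R h0 h1 hd).proj s (K x) = K ((ofContraction R h0 h1 hd).proj s x) :=
  starProjection_ker_commute hKN hK x

theorem ofContraction_proj_sqrt (s : ℝ) (x : H) :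
    (ofContraction R h0 h1 hd).proj s (CFC.sqrt R x) =
      CFC.sqrt R ((ofContraction R h0 h1 hd).proj s x) := by
  refine ofContraction_proj_commute h0 h1 hd (.of_nonneg (CFC.sqrt_nonneg R)) ?_ x
  rw [CFC.sqrt_eq_real_sqrt R h0, cfcₙ_eq_cfc]
  exact cfc_commute_cfc _ _ R

theorem negCut_apply_of_proj_eq {s : ℝ} {y : H} (hy : (ofContraction R h0 h1 hd).proj s y = y) :
    negCut R s y = 0 := by
  have := Submodule.starProjection_apply_mem (negCut R s).ker y
  change (ofContraction R h0 h1 hd).proj s y ∈ _ at this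
  rw [hy] at this
  exact this

theorem re_inner_posCut {R : H →L[ℂ] H} (h0 : 0 ≤ R) (s : ℝ) (y : H) :
    (⟪y, posCut R s y⟫_ℂ).re =
      (1 + s) * (⟪y, R y⟫_ℂ).re - ‖y‖ ^ 2 + (⟪y, negCut R s y⟫_ℂ).re := by
  rw [posCut_apply h0, inner_add_right, inner_sub_right, inner_smul_right,
    inner_self_eq_norm_sq_to_K, Complex.add_re, Complex.sub_re, Complex.re_ofReal_mul]
  norm_cast

/-- The function which `R` is of `R⁻¹ - 1`, extended to the real line. -/
noncomputable def resolventFun (s : ℝ) : ℝ := (1 + max s 0)⁻¹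

theorem resolventFun_pos (s : ℝ) : 0 < resolventFun s := by
  have := le_max_right s 0
  rw [resolventFun]
  positivity

theorem resolventFun_le_one (s : ℝ) : resolventFun s ≤ 1 :=
  inv_le_one_of_one_le₀ (by linarith [le_max_right s 0])

theorem continuous_resolventFun : Continuous resolventFun := by
  refine Continuous.inv₀ (by fun_prop) fun s => ?_
  have := le_max_right s 0
  positivity

theorem resolventFun_anti : Antitone resolventFun := by
  intro s t h
  have := le_max_right s 0
  rw [resolventFun, resolventFun]
  gcongr

theorem resolventFun_sub_le {s t : ℝ} (h : s ≤ t) : resolventFun s - resolventFun t ≤ t - s := by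
  have hs := le_max_right s 0
  have ht := le_max_right t 0
  have h2 : max t 0 - max s 0 ≤ t - s := by
    have := abs_max_sub_max_le_abs t s 0
    rw [abs_of_nonneg (sub_nonneg.2 h)] at this
    exact (le_abs_self _).trans this
  have h3 : max s 0 ≤ max t 0 := max_le_max_right _ h
  have h4 : resolventFun s - resolventFun t =
      (max t 0 - max s 0) * ((1 + max s 0)⁻¹ * (1 + max t 0)⁻¹) := by
    have h5 : 1 + max s 0 ≠ 0 := by positivity
    have h6 : 1 + max t 0 ≠ 0 := by positivity
    rw [resolventFun, resolventFun]
    field_simp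
    ring
  have h5 : (1 + max s 0)⁻¹ * (1 + max t 0)⁻¹ ≤ 1 :=
    mul_le_one₀ (inv_le_one_of_one_le₀ (by linarith)) (by positivity)
      (inv_le_one_of_one_le₀ (by linarith))
  rw [h4]
  exact (mul_le_of_le_one_right (by linarith) h5).trans h2

/-- On the range of P_t the negative part vanishes, so (1 + t) R - 1 acts there as its positive
part. -/
theorem resolventFun_mul_norm_sq_le {t : ℝ} {y : H}
    (hy : (ofContraction R h0 h1 hd).proj t y = y) :
    resolventFun t * ‖y‖ ^ 2 ≤ (⟪y, R y⟫_ℂ).re := by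
  rcases lt_or_ge t 0 with ht | ht
  · rw [ofContraction_proj_of_neg h0 h1 hd ht] at hy
    rw [← hy]
    simp
  · have h2 := ((nonneg_iff_isPositive _).1 (posCut_nonneg (R := R) t)).re_inner_nonneg_right y
    rw [RCLike.re_to_complex, re_inner_posCut h0, negCut_apply_of_proj_eq h0 h1 hd hy,
      inner_zero_right, Complex.zero_re] at h2
    rw [resolventFun, max_eq_left ht, inv_mul_le_iff₀ (by positivity)]
    linarith

/-- The positive part maps into the range of P_s and commutes with P_s, so it kills `y` when P_s y =
0; only the negative part of (1 + s) R - 1 remains. -/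
theorem re_inner_le_resolventFun_mul {s : ℝ} {y : H}
    (hy : (ofContraction R h0 h1 hd).proj s y = 0) :
    (⟪y, R y⟫_ℂ).re ≤ resolventFun s * ‖y‖ ^ 2 := by
  rcases lt_or_ge s 0 with hs | hs
  · have h2 := ((le_def _ _).1 h1).re_inner_nonneg_right y
    rw [sub_apply, inner_sub_right, one_apply_eq_self, inner_self_eq_norm_sq_to_K] at h2
    rw [resolventFun, max_eq_right hs.le]
    simp only [map_sub, RCLike.re_to_complex, Complex.coe_algebraMap] at h2
    norm_cast at h2
    linarith
  · have h2 : posCut R s y = 0 := by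
      have h3 : (ofContraction R h0 h1 hd).proj s (posCut R s y) = posCut R s y :=
        Submodule.starProjection_eq_self_iff.2 (posCut_mem_ker_negCut s y)
      rw [← h3, ofContraction_proj_commute h0 h1 hd (.of_nonneg (posCut_nonneg s))
        (cfc_commute_cfc _ _ R), hy, map_zero]
    have h3 := re_inner_posCut h0 s y
    rw [h2, inner_zero_right, Complex.zero_re] at h3
    have h4 := ((nonneg_iff_isPositive _).1 (negCut_nonneg (R := R) s)).re_inner_nonneg_right y
    rw [RCLike.re_to_complex] at h4
    rw [resolventFun, max_eq_left hs, inv_mul_eq_div, le_div_iff₀ (by positivity)]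
    linarith

theorem norm_sqrt_apply_sq {R : H →L[ℂ] H} (h0 : 0 ≤ R) (y : H) :
    ‖CFC.sqrt R y‖ ^ 2 = (⟪y, R y⟫_ℂ).re := by
  have hs : (CFC.sqrt R).IsPositive := (nonneg_iff_isPositive _).1 (CFC.sqrt_nonneg R)
  nth_rw 2 [← CFC.sqrt_mul_sqrt_self R h0]
  rw [mul_apply_eq_comp, ← hs.inner_left_eq_inner_right, inner_self_eq_norm_sq_to_K]
  norm_cast

theorem norm_sqrt_proj_sub {s t : ℝ} (h : s ≤ t) (x : H) :
    ‖CFC.sqrt R ((ofContraction R h0 h1 hd).proj t x)‖ ^ 2 -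
        ‖CFC.sqrt R ((ofContraction R h0 h1 hd).proj s x)‖ ^ 2 =
      ‖CFC.sqrt R ((ofContraction R h0 h1 hd).proj t x - (ofContraction R h0 h1 hd).proj s x)‖ ^ 2
      := by
  rw [← ofContraction_proj_sqrt, ← ofContraction_proj_sqrt, map_sub, ← ofContraction_proj_sqrt,
    ← ofContraction_proj_sqrt, norm_proj_sub_sq _ h]

/-- Put y = (P_t - P_s) x. Over (s, t] the increments of both sides lie between ρ(t)‖y‖² and
ρ(s)‖y‖², where ρ = `resolventFun` is 1-Lipschitz. Their difference thus satisfies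
`eq_of_abs_sub_le_mul_sub` with m = ‖P x‖², so it is constant, and it vanishes for negative
parameters. -/
theorem norm_sqrt_proj_sq (x : H) (s : ℝ) :
    ‖CFC.sqrt R ((ofContraction R h0 h1 hd).proj s x)‖ ^ 2 =
      ∫ r in Iic s, resolventFun r ∂((ofContraction R h0 h1 hd).measure x) := by
  set E := ofContraction R h0 h1 hd with hE
  have hint : Integrable resolventFun (E.measure x) :=
    Integrable.of_bound continuous_resolventFun.aestronglyMeasurable 1 (ae_of_all _ fun r => by
      rw [Real.norm_eq_abs, abs_of_pos (resolventFun_pos r)]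
      exact resolventFun_le_one r)
  set D : ℝ → ℝ := fun s => ‖CFC.sqrt R (E.proj s x)‖ ^ 2 -
    ∫ r in Iic s, resolventFun r ∂(E.measure x) with hD
  have hDlip : ∀ s t, s ≤ t → |D t - D s| ≤ (t - s) * (‖E.proj t x‖ ^ 2 - ‖E.proj s x‖ ^ 2) := by
    intro s t hst
    set y := E.proj t x - E.proj s x with hy
    have hy1 : E.proj t y = y := by
      rw [hy, map_sub, E.proj_apply_proj le_rfl, E.proj_apply_proj' hst]
    have hy2 : E.proj s y = 0 := by
      rw [hy, map_sub, E.proj_apply_proj le_rfl, E.proj_apply_proj hst, sub_self]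
    have hy3 := resolventFun_mul_norm_sq_le h0 h1 hd hy1
    have hy4 := re_inner_le_resolventFun_mul h0 h1 hd hy2
    have hI : ∫ r in Iic t, resolventFun r ∂(E.measure x) -
        ∫ r in Iic s, resolventFun r ∂(E.measure x) =
        ∫ r in Ioc s t, resolventFun r ∂(E.measure x) := by
      rw [← Iic_union_Ioc_eq_Iic hst, setIntegral_union (by
        rw [Set.disjoint_left]
        intro r (h2 : r ≤ s) h3
        exact absurd h3.1 h2.not_gt) measurableSet_Ioc hint.integrableOn hint.integrableOn]
      ring
    have hμ : (E.measure x).real (Ioc s t) = ‖y‖ ^ 2 := by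
      rw [Measure.real, measure_Ioc _ _ hst, ENNReal.toReal_ofReal (by positivity)]
    have hle : ∫ r in Ioc s t, resolventFun r ∂(E.measure x) ≤ resolventFun s * ‖y‖ ^ 2 := by
      rw [← hμ]
      refine (setIntegral_mono_on hint.integrableOn (integrable_const (resolventFun s))
        measurableSet_Ioc fun r hr => resolventFun_anti hr.1.le).trans_eq ?_
      simp [mul_comm]
    have hge : resolventFun t * ‖y‖ ^ 2 ≤ ∫ r in Ioc s t, resolventFun r ∂(E.measure x) := by
      rw [← hμ]
      refine Eq.trans_le ?_ (setIntegral_mono_on (integrable_const (resolventFun t))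
        hint.integrableOn measurableSet_Ioc fun r hr => resolventFun_anti hr.2)
      simp [mul_comm]
    have hS := norm_sqrt_proj_sub h0 h1 hd hst x
    rw [← hE, ← hy, norm_sqrt_apply_sq h0 y] at hS
    rw [← norm_proj_sub_sq _ hst, ← hy]
    have h2 : D t - D s = (⟪y, R y⟫_ℂ).re - ∫ r in Ioc s t, resolventFun r ∂(E.measure x) := by
      rw [← hI, ← hS]
      simp only [hD]
      ring
    have h3 := mul_le_mul_of_nonneg_right (resolventFun_sub_le hst) (sq_nonneg ‖y‖)
    rw [h2, abs_le]
    constructor <;> linarith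
  have hneg : ∀ r < 0, D r = 0 := by
    intro r hr
    have h2 := ofContraction_proj_of_neg h0 h1 hd hr
    rw [← hE] at h2
    have h3 : (E.measure x).restrict (Iic r) = 0 := by
      rw [Measure.restrict_eq_zero, measure_Iic, h2]
      simp
    simp [hD, h2, h3]
  have h2 : D (min s (-1)) = 0 := hneg _ (by linarith [min_le_right s (-1)])
  have h3 : D s = 0 := (eq_of_abs_sub_le_mul_sub hDlip (min_le_left s (-1))).trans h2
  exact sub_eq_zero.1 h3

/-- The square root makes the form of `R` a squared norm, hence a distribution function. Applying
this twice yields the density for `R x`. -/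
theorem measure_sqrt (x : H) :
    (ofContraction R h0 h1 hd).measure (CFC.sqrt R x) =
      ((ofContraction R h0 h1 hd).measure x).withDensity
        fun r => ENNReal.ofReal (resolventFun r) := by
  refine Measure.ext_of_Iic _ _ fun s => ?_
  rw [measure_Iic, ofContraction_proj_sqrt, norm_sqrt_proj_sq,
    withDensity_apply _ measurableSet_Iic, ofReal_integral_eq_lintegral_ofReal]
  · refine (Integrable.of_bound continuous_resolventFun.aestronglyMeasurable 1
      (ae_of_all _ fun r => ?_)).integrableOn
    rw [Real.norm_eq_abs, abs_of_pos (resolventFun_pos r)]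
    exact resolventFun_le_one r
  · exact ae_of_all _ fun r => (resolventFun_pos r).le

theorem measure_apply (x : H) :
    (ofContraction R h0 h1 hd).measure (R x) =
      ((ofContraction R h0 h1 hd).measure x).withDensity
        fun r => ENNReal.ofReal (resolventFun r ^ 2) := by
  have hm : Measurable fun r => ENNReal.ofReal (resolventFun r) :=
    continuous_resolventFun.measurable.ennreal_ofReal
  have h2 : R x = CFC.sqrt R (CFC.sqrt R x) := by
    rw [← mul_apply_eq_comp, CFC.sqrt_mul_sqrt_self R h0]
  rw [h2, measure_sqrt, measure_sqrt, ← withDensity_mul _ hm hm]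
  congr 1
  ext r
  rw [Pi.mul_apply, ← ENNReal.ofReal_mul (resolventFun_pos r).le, sq]

theorem integral_measure_apply (x : H) (g : ℝ → ℝ) :
    ∫ s, g s ∂((ofContraction R h0 h1 hd).measure (R x)) =
      ∫ s, resolventFun s ^ 2 * g s ∂((ofContraction R h0 h1 hd).measure x) := by
  have hm : Measurable fun r => ENNReal.ofReal (resolventFun r ^ 2) :=
    (continuous_resolventFun.measurable.pow_const 2).ennreal_ofReal
  rw [measure_apply, integral_withDensity_eq_integral_toReal_smul hm
    (ae_of_all _ fun _ => ENNReal.ofReal_lt_top)]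
  refine integral_congr_ae (ae_of_all _ fun s => ?_)
  simp [ENNReal.toReal_ofReal (sq_nonneg _)]

theorem integrable_measure_apply (x : H) (g : ℝ → ℝ) :
    Integrable g ((ofContraction R h0 h1 hd).measure (R x)) ↔
      Integrable (fun s => resolventFun s ^ 2 * g s) ((ofContraction R h0 h1 hd).measure x) := by
  have hm : Measurable fun r => ENNReal.ofReal (resolventFun r ^ 2) :=
    (continuous_resolventFun.measurable.pow_const 2).ennreal_ofReal
  rw [measure_apply, integrable_withDensity_iff_integrable_smul' hm
    (ae_of_all _ fun _ => ENNReal.ofReal_lt_top)]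
  simp [ENNReal.toReal_ofReal (sq_nonneg _)]

end SpectralFamily

namespace SpectralFamily

variable {H : Type*} [NormedAddCommGroup H] [InnerProductSpace ℂ H] [CompleteSpace H]
variable {R : H →L[ℂ] H} (h0 : 0 ≤ R) (h1 : R ≤ 1) (hd : DenseRange R)

theorem integrable_resolventFun_pow {E : SpectralFamily H} (x : H) (k : ℕ) :
    Integrable (fun s => resolventFun s ^ k) (E.measure x) :=
  Integrable.of_bound (continuous_resolventFun.pow k).aestronglyMeasurable 1
    (ae_of_all _ fun r => by
      rw [Real.norm_eq_abs, abs_of_pos (pow_pos (resolventFun_pos r) k)]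
      exact pow_le_one₀ (resolventFun_pos r).le (resolventFun_le_one r))

theorem ofContraction_ae_nonneg (x : H) :
    ∀ᵐ s ∂((ofContraction R h0 h1 hd).measure x), 0 ≤ s :=
  ae_nonneg_of_proj_eq_zero (fun _ => ofContraction_proj_of_neg h0 h1 hd) x

theorem norm_apply_sq_eq_integral (y : H) :
    ‖R y‖ ^ 2 = ∫ s, resolventFun s ^ 2 ∂((ofContraction R h0 h1 hd).measure y) := by
  rw [← measureReal_univ (ofContraction R h0 h1 hd)]
  have := integral_measure_apply h0 h1 hd y fun _ => 1
  simpa using this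

theorem norm_sq_eq_integral (y : H) :
    ‖y‖ ^ 2 = ∫ s, (resolventFun s ^ 2)⁻¹ ∂((ofContraction R h0 h1 hd).measure (R y)) := by
  rw [integral_measure_apply, ← measureReal_univ (ofContraction R h0 h1 hd)]
  have : ∀ s, resolventFun s ^ 2 * (resolventFun s ^ 2)⁻¹ = 1 := fun s =>
    mul_inv_cancel₀ (pow_pos (resolventFun_pos s) 2).ne'
  simp [this]

theorem inner_apply_eq_integral (y : H) :
    ⟪R y, y⟫_ℂ = ((∫ s, resolventFun s ∂((ofContraction R h0 h1 hd).measure y) : ℝ) : ℂ) := by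
  have h2 : ‖CFC.sqrt R y‖ ^ 2 = ∫ s, resolventFun s ∂((ofContraction R h0 h1 hd).measure y) := by
    rw [← measureReal_univ (ofContraction R h0 h1 hd), Measure.real, measure_sqrt,
      withDensity_apply _ MeasurableSet.univ, Measure.restrict_univ,
      integral_eq_lintegral_of_nonneg_ae (ae_of_all _ fun s => (resolventFun_pos s).le)
        continuous_resolventFun.aestronglyMeasurable]
  have hs : (CFC.sqrt R).IsPositive :=
    (ContinuousLinearMap.nonneg_iff_isPositive _).1 (CFC.sqrt_nonneg R)
  rw [← h2]
  nth_rw 1 [← CFC.sqrt_mul_sqrt_self R h0]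
  rw [mul_apply_eq_comp, hs.inner_left_eq_inner_right, inner_self_eq_norm_sq_to_K]
  norm_cast

theorem resolventFun_sub_sq {s : ℝ} (hs : 0 ≤ s) :
    resolventFun s - resolventFun s ^ 2 = resolventFun s ^ 2 * s := by
  have : 1 + s ≠ 0 := by positivity
  rw [resolventFun, max_eq_left hs]
  field_simp
  ring

/-- Each P_n x has a preimage y_n under `R`, since `R` is invertible on the range of P_n. The
distance ‖y_n - y_m‖² is an integral of (1 + s)² over (m, n], so y_n is Cauchy, and `R` maps its
limit to `x`. -/
theorem mem_range_of_integrable_sq {x : H}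
    (hx : Integrable (fun s : ℝ => s ^ 2) ((ofContraction R h0 h1 hd).measure x)) :
    x ∈ range R := by
  set E := ofContraction R h0 h1 hd with hE
  have hw : Integrable (fun s => (resolventFun s ^ 2)⁻¹) (E.measure x) := by
    refine ((hx.add (integrable_const 1)).const_mul 2).mono'
      ((continuous_resolventFun.pow 2).inv₀ fun s =>
        (pow_pos (resolventFun_pos s) 2).ne').aestronglyMeasurable ?_
    filter_upwards [ofContraction_ae_nonneg h0 h1 hd x] with s hs
    have h2 := pow_pos (resolventFun_pos s) 2
    rw [Real.norm_eq_abs, abs_of_pos (inv_pos.2 h2), resolventFun, max_eq_left hs, inv_pow, inv_inv]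
    simp only [Pi.add_apply]
    nlinarith [sq_nonneg (s - 1)]
  have hy : ∀ n : ℕ, ∃ y, R y = E.proj n x := by
    intro n
    obtain ⟨K, hK⟩ := ContinuousLinearMap.exists_mul_eq_one_sub_negCut h0 (Nat.cast_nonneg n)
    refine ⟨K (E.proj n x), ?_⟩
    have h2 := congrArg (fun A : H →L[ℂ] H => A (E.proj n x)) hK
    have h3 := negCut_apply_of_proj_eq h0 h1 hd (E.proj_apply_proj (le_refl (n : ℝ)) x)
    simpa [h3] using h2
  choose y hy using hy
  have hdist : ∀ m n : ℕ, m ≤ n → ‖y n - y m‖ ^ 2 ≤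
      ∫ s in Ioi (m : ℝ), (resolventFun s ^ 2)⁻¹ ∂(E.measure x) := by
    intro m n hmn
    have h2 : R (y n - y m) = E.proj n x - E.proj m (E.proj n x) := by
      rw [map_sub, hy, hy, E.proj_apply_proj (Nat.cast_le.2 hmn)]
    rw [norm_sq_eq_integral h0 h1 hd, h2, ← hE, measure_sub_proj, measure_proj,
      Measure.restrict_restrict measurableSet_Ioi]
    refine setIntegral_mono_set hw.integrableOn
      (ae_of_all _ fun s => (inv_pos.2 (pow_pos (resolventFun_pos s) 2)).le) ?_
    exact inter_subset_left.eventuallyLE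
  have hlim : Tendsto (fun m : ℕ => ∫ s in Ioi (m : ℝ), (resolventFun s ^ 2)⁻¹ ∂(E.measure x))
      atTop (𝓝 0) := by
    have h2 := tendsto_setIntegral_of_antitone (μ := E.measure x) (s := fun m : ℕ => Ioi (m : ℝ))
      (fun _ => measurableSet_Ioi) (fun m n hmn => Ioi_subset_Ioi (Nat.cast_le.2 hmn))
      ⟨0, hw.integrableOn⟩
    have h3 : ⋂ m : ℕ, Ioi (m : ℝ) = ∅ := by
      rw [eq_empty_iff_forall_notMem]
      intro s hs
      obtain ⟨m, hm⟩ := exists_nat_gt s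
      exact absurd (mem_iInter.1 hs m) (not_lt.2 hm.le)
    simpa [h3] using h2
  have hc : CauchySeq y := by
    refine cauchySeq_of_le_tendsto_0'
      (fun m : ℕ => √(∫ s in Ioi (m : ℝ), (resolventFun s ^ 2)⁻¹ ∂(E.measure x))) ?_ ?_
    · intro m n hmn
      rw [dist_comm, dist_eq_norm]
      exact Real.le_sqrt_of_sq_le (hdist m n hmn)
    · simpa using hlim.sqrt
  obtain ⟨z, hz⟩ := cauchySeq_tendsto_of_complete hc
  refine ⟨z, tendsto_nhds_unique ((R.continuous.tendsto z).comp hz) ?_⟩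
  simp only [Function.comp_def, hy]
  exact (E.tendsto_atTop x).comp tendsto_natCast_atTop_atTop

end SpectralFamily

/-- The spectral theorem for positive self-adjoint operators. -/
theorem LinearPMap.exists_resolves {H : Type*} [NormedAddCommGroup H] [InnerProductSpace ℂ H]
    [CompleteSpace H] {T : H →ₗ.[ℂ] H} (hT : IsSelfAdjoint T)
    (hpos : ∀ x : T.domain, 0 ≤ (⟪(x : H), T x⟫_ℂ).re) :
    ∃ E : SpectralFamily H, E.Resolves T := by
  obtain ⟨R, hR, hR'⟩ := exists_resolvent hT hpos
  have h0 := resolvent_nonneg hT hpos hR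
  have h1 := resolvent_le_one hT hpos hR
  have hd : DenseRange R := hT.dense_domain.mono fun x hx => ⟨x + T ⟨x, hx⟩, hR' ⟨x, hx⟩⟩
  refine ⟨SpectralFamily.ofContraction R h0 h1 hd, fun x => ⟨fun hx => ?_, fun hx => ?_⟩,
    fun x => ?_⟩
  · have h2 : x = R (x + T ⟨x, hx⟩) := (hR' ⟨x, hx⟩).symm
    rw [h2, SpectralFamily.integrable_measure_apply]
    -- The change of measure leaves the integrand (s / (1 + s))² on [0, ∞).
    refine Integrable.of_bound (C := 1) ?_ ?_
    · exact ((SpectralFamily.continuous_resolventFun.pow 2).mul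
        (continuous_pow 2)).aestronglyMeasurable
    · filter_upwards [SpectralFamily.ofContraction_ae_nonneg h0 h1 hd _] with s hs
      have h3 : 0 ≤ SpectralFamily.resolventFun s * s :=
        mul_nonneg (SpectralFamily.resolventFun_pos s).le hs
      have h4 : SpectralFamily.resolventFun s * s ≤ 1 := by
        rw [SpectralFamily.resolventFun, max_eq_left hs, inv_mul_le_iff₀ (by positivity)]
        linarith
      rw [← mul_pow, Real.norm_eq_abs, abs_of_nonneg (by positivity)]
      exact pow_le_one₀ h3 h4
  · obtain ⟨y, rfl⟩ := SpectralFamily.mem_range_of_integrable_sq h0 h1 hd hx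
    exact (hR y).1
  · set y := (x : H) + T x with hy
    have h2 : (x : H) = R y := (hR' x).symm
    have h3 : T x = y - R y := by rw [← h2, hy]; abel
    have h4 := SpectralFamily.norm_apply_sq_eq_integral h0 h1 hd y
    have h5 : ⟪R y, R y⟫_ℂ = ((‖R y‖ ^ 2 : ℝ) : ℂ) := by
      rw [inner_self_eq_norm_sq_to_K]
      norm_cast
    -- With ρ = `resolventFun`, ⟪R y, y - R y⟫ = ∫ (ρ - ρ²) dμ_y, and ρ - ρ² = ρ² s turns this into
    -- the integral of s against the measure of R y.
    rw [h3, h2, inner_sub_right, SpectralFamily.inner_apply_eq_integral h0 h1 hd,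
      h5, SpectralFamily.integral_measure_apply, h4, ← Complex.ofReal_sub,
      ← integral_sub (by simpa using SpectralFamily.integrable_resolventFun_pow y 1)
        (SpectralFamily.integrable_resolventFun_pow y 2)]
    congr 1
    refine integral_congr_ae ?_
    filter_upwards [SpectralFamily.ofContraction_ae_nonneg h0 h1 hd y] with s hs
    exact SpectralFamily.resolventFun_sub_sq hs

/-! ### Estimates for Schwartz functions and their dilates. -/

namespace SchwartzMap

theorem exists_pow_mul_eq (f₀ : 𝓢(ℝ, ℂ)) (l : ℕ) :
    ∃ F : 𝓢(ℝ, ℂ), ∀ s : ℝ, F s = (s : ℂ) ^ l * f₀ s :=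
  ⟨smulLeftCLM ℂ (fun s : ℝ => (s : ℂ) ^ l) f₀, fun s => by
    rw [smulLeftCLM_apply_apply (by fun_prop), smul_eq_mul]⟩

theorem exists_norm_le (F : 𝓢(ℝ, ℂ)) : ∃ C, 0 < C ∧ ∀ s, ‖F s‖ ≤ C := by
  obtain ⟨C, hC, h⟩ := F.decay 0 0
  exact ⟨C, hC, fun s => by simpa using h s⟩

/-- The factor s cancels the singularity at 0: |F|² / t = |G| |F|, bounded times integrable. -/
theorem integrableOn_norm_sq_div {F G : 𝓢(ℝ, ℂ)} (h : ∀ s : ℝ, F s = s * G s) :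
    IntegrableOn (fun t : ℝ => ‖F t‖ ^ 2 / t) (Ioi 0) := by
  obtain ⟨C, hC, hG⟩ := G.exists_norm_le
  have hF : IntegrableOn (fun t => C * ‖F t‖) (Ioi 0) :=
    (F.integrable.norm.const_mul C).integrableOn
  refine hF.mono' ?_ ?_
  · refine Measurable.aestronglyMeasurable ?_
    have := F.continuous.measurable
    fun_prop
  · refine (ae_restrict_mem measurableSet_Ioi).mono fun t ht => ?_
    have ht' : 0 < t := ht
    have h2 : ‖F t‖ ^ 2 / t = ‖G t‖ * ‖F t‖ := by
      rw [div_eq_iff ht'.ne', sq]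
      nth_rw 1 [h t]
      rw [norm_mul, Complex.norm_real, Real.norm_eq_abs, abs_of_pos ht']
      ring
    rw [h2, Real.norm_eq_abs, abs_of_nonneg (by positivity)]
    gcongr
    exact hG t

/-- Dilations act continuously on the squared modulus of a Schwartz function. -/
theorem exists_abs_norm_sq_dilate_sub_le (F : 𝓢(ℝ, ℂ)) {ε : ℝ} (hε : 0 < ε) :
    ∃ C, 0 ≤ C ∧ ∀ t u s : ℝ, ε ≤ t → ε ≤ u →
      |‖F (t * s)‖ ^ 2 - ‖F (u * s)‖ ^ 2| ≤ C * |t - u| := by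
  obtain ⟨M, hM, hFM⟩ := F.exists_norm_le
  obtain ⟨C, hC, hF'⟩ := (derivCLM ℝ ℂ F).decay 1 0
  have hderiv : ∀ s, ‖s‖ * ‖deriv F s‖ ≤ C := fun s => by simpa using hF' s
  refine ⟨2 * M * (C / ε), by positivity, fun t u s ht hu => ?_⟩
  -- The t-derivative s F'(ts) is bounded by sup |r F'(r)| / t, uniformly in `s`.
  have h1 : ‖F (t * s) - F (u * s)‖ ≤ C / ε * ‖t - u‖ := by
    refine Convex.norm_image_sub_le_of_norm_hasDerivWithin_le (s := Ici ε)
      (f := fun t => F (t * s)) (f' := fun t => s • deriv F (t * s)) (fun r _ => ?_)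
      (fun r hr => ?_) (convex_Ici ε) hu ht
    · have h2 : HasDerivAt F (deriv F (r * s)) (r * s) := F.differentiableAt.hasDerivAt
      exact (h2.scomp r (hasDerivAt_mul_const s)).hasDerivWithinAt
    · have hr0 : 0 < r := hε.trans_le hr
      have h2 := hderiv (r * s)
      rw [norm_mul, Real.norm_eq_abs r, abs_of_pos hr0] at h2
      rw [norm_smul, le_div_iff₀ hε]
      calc ‖s‖ * ‖deriv F (r * s)‖ * ε ≤ ‖s‖ * ‖deriv F (r * s)‖ * r := by gcongr; exact hr
        _ ≤ C := by linarith
  have h3 : |‖F (t * s)‖ - ‖F (u * s)‖| ≤ C / ε * |t - u| := (abs_norm_sub_norm_le _ _).trans h1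
  have h4 : ‖F (t * s)‖ ^ 2 - ‖F (u * s)‖ ^ 2 =
      (‖F (t * s)‖ + ‖F (u * s)‖) * (‖F (t * s)‖ - ‖F (u * s)‖) := by ring
  rw [h4, abs_mul, abs_of_nonneg (by positivity), mul_assoc]
  gcongr
  linarith [hFM (t * s), hFM (u * s)]

theorem continuous_norm_sq_dilate (F : 𝓢(ℝ, ℂ)) (t : ℝ) : Continuous fun s => ‖F (t * s)‖ ^ 2 :=
  ((F.continuous.comp (continuous_const_mul t)).norm).pow 2

theorem tendsto_norm_sq_dilate (F : 𝓢(ℝ, ℂ)) {t : ℝ} (ht : t ≠ 0) :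
    Tendsto (fun s => ‖F (t * s)‖ ^ 2) (cocompact ℝ) (𝓝 0) := by
  have h := ((F.tendsto_cocompact.comp
    (Homeomorph.mulLeft₀ t ht).isClosedEmbedding.tendsto_cocompact).norm).pow 2
  rw [norm_zero, zero_pow two_ne_zero] at h
  exact h

end SchwartzMap

/-! ### The scalar integrals over dt/t. -/

section TruncatedIntegral

variable {g : ℝ → ℝ}

/-- The substitution u = ts preserves dt/t. The indicator produces an integrand that is integrable
on the whole line, so that primitives from 0 can be used. -/
theorem integral_dilate_eq_sub {ε N s : ℝ} (hε : 0 < ε) (hN : 0 < N) (hs : 0 < s) :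
    ∫ t in ε..N, t⁻¹ * g (t * s) =
      ∫ u in (ε * s)..(N * s), (Ioi 0).indicator (fun t => g t / t) u := by
  have h1 : ∫ t in ε..N, t⁻¹ * g (t * s) = ∫ t in ε..N, s * (g (t * s) / (t * s)) := by
    refine intervalIntegral.integral_congr fun t ht => ?_
    have ht0 : 0 < t := (lt_min hε hN).trans_le ht.1
    field_simp
  rw [h1, intervalIntegral.integral_const_mul,
    intervalIntegral.integral_comp_mul_right (fun u => g u / u) hs.ne', smul_eq_mul,
    mul_inv_cancel_left₀ hs.ne']
  refine intervalIntegral.integral_congr fun u hu => ?_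
  have hu0 : 0 < u := (lt_min (mul_pos hε hs) (mul_pos hN hs)).trans_le hu.1
  simp [indicator, hu0]

theorem integral_dilate_mem_Icc (hg0 : g 0 = 0) (hpos : ∀ s, 0 ≤ g s)
    (hint : IntegrableOn (fun t => g t / t) (Ioi 0))
    {ε N s : ℝ} (hε : 0 < ε) (hN : ε ≤ N) (hs : 0 ≤ s) :
    ∫ t in ε..N, t⁻¹ * g (t * s) ∈
      Icc 0 ((Ioi 0).indicator (fun _ => ∫ t in Ioi 0, g t / t) s) := by
  rcases hs.eq_or_lt with rfl | hs
  · simp [hg0]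
  · have hnn : ∀ u, 0 ≤ (Ioi 0).indicator (fun t => g t / t) u := fun u =>
      indicator_nonneg (fun t (ht : 0 < t) => div_nonneg (hpos t) ht.le) u
    rw [integral_dilate_eq_sub hε (hε.trans_le hN) hs,
      indicator_of_mem (show s ∈ Ioi 0 from hs), ← integral_indicator measurableSet_Ioi,
      intervalIntegral.integral_of_le (by gcongr)]
    exact ⟨integral_nonneg hnn, setIntegral_le_integral
      ((integrable_indicator_iff measurableSet_Ioi).2 hint) (ae_of_all _ hnn)⟩

theorem tendsto_integral_dilate (hg0 : g 0 = 0)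
    (hint : IntegrableOn (fun t => g t / t) (Ioi 0)) {s : ℝ} (hs : 0 ≤ s) :
    Tendsto (fun p : ℝ × ℝ => ∫ t in p.1..p.2, t⁻¹ * g (t * s)) (𝓝[>] (0 : ℝ) ×ˢ atTop)
      (𝓝 ((Ioi 0).indicator (fun _ => ∫ t in Ioi 0, g t / t) s)) := by
  rcases hs.eq_or_lt with rfl | hs
  · simp [hg0]
  · set h := (Ioi 0).indicator fun t => g t / t with hh
    have hi : Integrable h := (integrable_indicator_iff measurableSet_Ioi).2 hint
    have hii : ∀ a b, IntervalIntegrable h volume a b := fun a b => hi.intervalIntegrable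
    rw [indicator_of_mem (show s ∈ Ioi 0 from hs)]
    have h1 : Tendsto (fun p : ℝ × ℝ => ∫ u in (0 : ℝ)..(p.2 * s), h u) (𝓝[>] (0 : ℝ) ×ˢ atTop)
        (𝓝 (∫ t in Ioi 0, g t / t)) := by
      have h2 := intervalIntegral_tendsto_integral_Ioi 0 hi.integrableOn
        ((tendsto_id.atTop_mul_const hs).comp tendsto_snd :
          Tendsto (fun p : ℝ × ℝ => p.2 * s) (𝓝[>] (0 : ℝ) ×ˢ atTop) atTop)
      have h3 : ∫ u in Ioi 0, h u = ∫ t in Ioi 0, g t / t := by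
        rw [hh, setIntegral_indicator measurableSet_Ioi, inter_self]
      rwa [h3] at h2
    have h2 : Tendsto (fun p : ℝ × ℝ => ∫ u in (0 : ℝ)..(p.1 * s), h u) (𝓝[>] (0 : ℝ) ×ˢ atTop)
        (𝓝 0) := by
      have hc := (intervalIntegral.continuous_primitive hii 0).comp (continuous_mul_const s)
      have h3 := (tendsto_nhdsWithin_of_tendsto_nhds (s := Ioi 0) (hc.tendsto 0))
      simp only [Function.comp_def, zero_mul, intervalIntegral.integral_same] at h3
      exact h3.comp tendsto_fst
    have h3 := h1.sub h2
    rw [sub_zero] at h3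
    refine h3.congr' ?_
    have he : ∀ᶠ p : ℝ × ℝ in 𝓝[>] (0 : ℝ) ×ˢ atTop, 0 < p.1 ∧ 0 < p.2 :=
      (eventually_mem_nhdsWithin : ∀ᶠ x in 𝓝[>] (0 : ℝ), x ∈ Ioi 0).prod_mk
        (eventually_gt_atTop (0 : ℝ))
    filter_upwards [he] with p hp
    rw [integral_dilate_eq_sub hp.1 hp.2 hs,
      intervalIntegral.integral_interval_sub_left (hii _ _) (hii _ _)]

end TruncatedIntegral

/-! ### Strong convergence of the truncated operator integrals. -/

namespace LinearPMap

variable {H : Type*} [NormedAddCommGroup H] [InnerProductSpace ℂ H] [CompleteSpace H]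

/-- The functional calculus is the integral for one and the same spectral family. -/
theorem exists_isIntegral_funcCalc {T : H →ₗ.[ℂ] H} (hT : IsSelfAdjoint T)
    (hpos : ∀ x : T.domain, 0 ≤ (⟪(x : H), T x⟫_ℂ).re) :
    ∃ E : SpectralFamily H, E.Resolves T ∧ ∀ g : ℝ → ℝ, Continuous g →
      Tendsto g (cocompact ℝ) (𝓝 0) → E.IsIntegral g (T.funcCalc g) := by
  have h := exists_resolves hT hpos
  refine ⟨h.choose, h.choose_spec, fun g hg hg0 => ?_⟩
  obtain ⟨S, hS⟩ := h.choose.exists_isIntegral_of_continuous hg hg0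
  rw [funcCalc, dif_pos h, hS.integral_eq]
  exact hS

end LinearPMap

namespace SpectralFamily

variable {H : Type*} [NormedAddCommGroup H] [InnerProductSpace ℂ H] [CompleteSpace H]
variable {E : SpectralFamily H}

theorem isIntegral_indicator_Ioi (s : ℝ) :
    E.IsIntegral ((Ioi s).indicator fun _ => 1) (1 - E.proj s) := by
  convert isIntegral_one.sub (isIntegral_indicator_Iic s) using 1
  ext r
  by_cases h : s < r
  · simp [indicator, h, not_le.2 h]
  · simp [indicator, h, not_lt.1 h]

variable {F : 𝓢(ℝ, ℂ)} {S : ℝ → H →L[ℂ] H}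

theorem continuousOn_dilate
    (hS : ∀ t, 0 < t → E.IsIntegral (fun s => ‖F (t * s)‖ ^ 2) (S t)) : ContinuousOn S (Ioi 0) := by
  intro t ht
  have ht' : 0 < t / 2 := half_pos ht
  obtain ⟨C, hC, h⟩ := F.exists_abs_norm_sq_dilate_sub_le ht'
  refine ContinuousAt.continuousWithinAt ?_
  rw [ContinuousAt, tendsto_iff_norm_sub_tendsto_zero]
  have hlim : Tendsto (fun u => 3 * (C * |u - t|)) (𝓝 t) (𝓝 0) := by
    have : Continuous fun u => 3 * (C * |u - t|) := by fun_prop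
    simpa using this.tendsto t
  refine squeeze_zero' (Eventually.of_forall fun _ => norm_nonneg _) ?_ hlim
  have hlt : t / 2 < t := half_lt_self ht
  filter_upwards [lt_mem_nhds hlt] with u hu
  exact ((hS u (ht'.trans hu)).sub (hS t ht)).opNorm_le (by positivity)
    fun s => h u t s hu.le hlt.le

theorem intervalIntegrable_dilate
    (hS : ∀ t, 0 < t → E.IsIntegral (fun s => ‖F (t * s)‖ ^ 2) (S t))
    {ε N : ℝ} (hε : 0 < ε) (hN : 0 < N) :
    IntervalIntegrable (fun t : ℝ => ((t⁻¹ : ℝ) : ℂ) • S t) volume ε N := by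
  have hsub : uIcc ε N ⊆ Ioi 0 := fun t ht => (lt_min hε hN).trans_le ht.1
  have hinv : ContinuousOn (fun t : ℝ => ((t⁻¹ : ℝ) : ℂ)) (uIcc ε N) :=
    Complex.continuous_ofReal.comp_continuousOn
      (continuousOn_inv₀.mono fun t ht => (hsub ht).ne')
  exact (hinv.smul ((continuousOn_dilate hS).mono hsub)).intervalIntegrable

/-- Fubini on (ε, N] × ℝ, where the integrand is dominated by M² / t. -/
theorem isIntegral_intervalIntegral_dilate
    (hS : ∀ t, 0 < t → E.IsIntegral (fun s => ‖F (t * s)‖ ^ 2) (S t))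
    {ε N : ℝ} (hε : 0 < ε) (hN : ε ≤ N) :
    E.IsIntegral (fun s => ∫ t in ε..N, t⁻¹ * ‖F (t * s)‖ ^ 2)
      (∫ t in ε..N, ((t⁻¹ : ℝ) : ℂ) • S t) := by
  intro x
  obtain ⟨M, hM, hFM⟩ := F.exists_norm_le
  have hI : Integrable (Function.uncurry fun t s => t⁻¹ * ‖F (t * s)‖ ^ 2)
      ((volume.restrict (Ioc ε N)).prod (E.measure x)) := by
    have hi : IntegrableOn (fun t : ℝ => |t⁻¹|) (Ioc ε N) := by
      have : IntervalIntegrable (fun t : ℝ => t⁻¹) volume ε N := by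
        refine ContinuousOn.intervalIntegrable (continuousOn_inv₀.mono fun t ht => ?_)
        rw [uIcc_of_le hN] at ht
        exact (hε.trans_le ht.1).ne'
      exact this.1.abs
    have hb : Integrable (fun z : ℝ × ℝ => |z.1⁻¹| * M ^ 2)
        ((volume.restrict (Ioc ε N)).prod (E.measure x)) :=
      Integrable.mul_prod hi (integrable_const (M ^ 2))
    refine hb.mono' ?_ (ae_of_all _ fun z => ?_)
    · refine Measurable.aestronglyMeasurable ?_
      have := F.continuous.measurable
      simp only [Function.uncurry_def]
      fun_prop
    · simp only [Function.uncurry_def, norm_mul, norm_pow, Real.norm_eq_abs, abs_norm]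
      gcongr
      exact hFM _
  refine ⟨?_, ?_⟩
  · simp only [intervalIntegral.integral_of_le hN]
    exact hI.integral_prod_right
  · let L : (H →L[ℂ] H) →L[ℂ] ℂ := (innerSL ℂ x).comp (ContinuousLinearMap.apply ℂ H x)
    have hL : ∀ A, L A = ⟪x, A x⟫_ℂ := fun A => rfl
    rw [← hL, ← L.intervalIntegral_comp_comm (intervalIntegrable_dilate hS hε (hε.trans_le hN))]
    have h1 : ∫ t in ε..N, L (((t⁻¹ : ℝ) : ℂ) • S t) =
        ∫ t in ε..N, ((t⁻¹ * ∫ s, ‖F (t * s)‖ ^ 2 ∂(E.measure x) : ℝ) : ℂ) := by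
      refine intervalIntegral.integral_congr fun t ht => ?_
      rw [uIcc_of_le hN] at ht
      rw [map_smul, hL, (hS t (hε.trans_le ht.1) x).2, smul_eq_mul, Complex.ofReal_mul]
    rw [h1, intervalIntegral.integral_ofReal]
    congr 1
    simp only [intervalIntegral.integral_of_le hN, ← integral_const_mul]
    exact integral_integral_swap hI

/-- The remainder has an integrand with values in [0, c] on [0, ∞), so its squared norm at `x` is at
most `c` times the integral of that integrand against μ_x, which tends to 0 by dominated
convergence. -/
theorem tendsto_intervalIntegral_dilate
    (hS : ∀ t, 0 < t → E.IsIntegral (fun s => ‖F (t * s)‖ ^ 2) (S t))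
    (hE : ∀ x, ∀ᵐ s ∂(E.measure x), 0 ≤ s) (hF0 : F 0 = 0)
    (hint : IntegrableOn (fun t : ℝ => ‖F t‖ ^ 2 / t) (Ioi 0)) (x : H) :
    Tendsto (fun p : ℝ × ℝ => (∫ t in p.1..p.2, ((t⁻¹ : ℝ) : ℂ) • S t) x)
      (𝓝[>] (0 : ℝ) ×ˢ atTop)
      (𝓝 ((((∫ t in Ioi (0 : ℝ), ‖F t‖ ^ 2 / t : ℝ) : ℂ) • (1 - E.proj 0)) x)) := by
  set c := ∫ t in Ioi (0 : ℝ), ‖F t‖ ^ 2 / t with hc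
  have hg0 : ‖F 0‖ ^ 2 = 0 := by simp [hF0]
  have hgpos : ∀ s, 0 ≤ ‖F s‖ ^ 2 := fun s => by positivity
  have hc0 : 0 ≤ c := setIntegral_nonneg measurableSet_Ioi fun t ht =>
    div_nonneg (hgpos t) (le_of_lt ht)
  set φ : ℝ × ℝ → ℝ → ℝ := fun p s => ∫ t in p.1..p.2, t⁻¹ * ‖F (t * s)‖ ^ 2 with hφ
  have he : ∀ᶠ p : ℝ × ℝ in 𝓝[>] (0 : ℝ) ×ˢ atTop, 0 < p.1 ∧ p.1 ≤ p.2 := by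
    have h1 : ∀ᶠ p : ℝ × ℝ in 𝓝[>] (0 : ℝ) ×ˢ atTop, (0 < p.1 ∧ p.1 < 1) ∧ 1 < p.2 :=
      ((eventually_mem_nhdsWithin : ∀ᶠ x in 𝓝[>] (0 : ℝ), x ∈ Ioi 0).and
        (eventually_nhdsWithin_of_eventually_nhds (gt_mem_nhds one_pos))).prod_mk
        (eventually_gt_atTop (1 : ℝ))
    filter_upwards [h1] with p hp
    exact ⟨hp.1.1, (hp.1.2.trans hp.2).le⟩
  have hψ : ∀ p : ℝ × ℝ, 0 < p.1 → p.1 ≤ p.2 → E.IsIntegral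
      (fun s => c * (Ioi 0).indicator (fun _ => 1) s - φ p s)
      ((c : ℂ) • (1 - E.proj 0) - ∫ t in p.1..p.2, ((t⁻¹ : ℝ) : ℂ) • S t) := fun p h1 h2 =>
    ((isIntegral_indicator_Ioi 0).const_mul c).sub (isIntegral_intervalIntegral_dilate hS h1 h2)
  have hind : ∀ s : ℝ, (Ioi 0).indicator (fun _ => c) s = c * (Ioi 0).indicator (fun _ => 1) s := by
    intro s
    by_cases h : 0 < s <;> simp [indicator, h]
  have hψmem : ∀ p : ℝ × ℝ, 0 < p.1 → p.1 ≤ p.2 → ∀ s, 0 ≤ s →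
      0 ≤ c * (Ioi 0).indicator (fun _ => 1) s - φ p s ∧
        c * (Ioi 0).indicator (fun _ => 1) s - φ p s ≤ c := by
    intro p h1 h2 s hs
    obtain ⟨h3, h4⟩ := integral_dilate_mem_Icc (g := fun t => ‖F t‖ ^ 2) hg0 hgpos hint h1 h2 hs
    rw [← hc] at h4
    have h5 : (Ioi 0).indicator (fun _ => c) s ≤ c := indicator_le_self' (fun _ _ => hc0) s
    rw [← hind]
    exact ⟨sub_nonneg.2 h4, (sub_le_self _ h3).trans h5⟩
  have hlim : Tendsto (fun p => ∫ s, (c * (Ioi 0).indicator (fun _ => 1) s - φ p s) ∂(E.measure x))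
      (𝓝[>] (0 : ℝ) ×ˢ atTop) (𝓝 (∫ _, 0 ∂(E.measure x))) := by
    refine tendsto_integral_filter_of_dominated_convergence (fun _ => c) ?_ ?_
      (integrable_const _) ?_
    · filter_upwards [he] with p hp using (hψ p hp.1 hp.2 x).1.aestronglyMeasurable
    · filter_upwards [he] with p hp
      filter_upwards [hE x] with s hs
      obtain ⟨h1, h2⟩ := hψmem p hp.1 hp.2 s hs
      rwa [Real.norm_eq_abs, abs_of_nonneg h1]
    · filter_upwards [hE x] with s hs
      have h1 := tendsto_integral_dilate (g := fun t => ‖F t‖ ^ 2) hg0 hint hs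
      rw [← hc, hind] at h1
      simpa using h1.const_sub (c * (Ioi 0).indicator (fun _ => 1) s)
  rw [integral_zero] at hlim
  have hlim2 : Tendsto (fun p : ℝ × ℝ =>
      ((c : ℂ) • (1 - E.proj 0) - ∫ t in p.1..p.2, ((t⁻¹ : ℝ) : ℂ) • S t) x)
      (𝓝[>] (0 : ℝ) ×ˢ atTop) (𝓝 0) := by
    rw [tendsto_zero_iff_norm_tendsto_zero]
    have h1 := (hlim.const_mul c).sqrt
    rw [mul_zero, Real.sqrt_zero] at h1
    refine squeeze_zero' (Eventually.of_forall fun _ => norm_nonneg _) ?_ h1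
    filter_upwards [he] with p hp
    refine Real.le_sqrt_of_sq_le ((hψ p hp.1 hp.2).norm_apply_sq_le (fun y => ?_) (fun y => ?_) x)
    · filter_upwards [hE y] with s hs using (hψmem p hp.1 hp.2 s hs).1
    · filter_upwards [hE y] with s hs using (hψmem p hp.1 hp.2 s hs).2
  have h1 := hlim2.const_sub (((c : ℂ) • (1 - E.proj 0)) x)
  rw [sub_zero] at h1
  refine h1.congr fun p => ?_
  rw [sub_apply, sub_sub_cancel]

end SpectralFamily

/-! ### Strong convergence of series of positive operators. -/

namespace SpectralFamily

variable {H : Type*} [NormedAddCommGroup H] [InnerProductSpace ℂ H] [CompleteSpace H]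
variable {E : SpectralFamily H}

/-- Strong convergence of a series of operators `∫ g i dP_s` with `g i ≥ 0` whose sum is bounded. -/
theorem exists_hasSum_isIntegral {ι : Type*} [Countable ι] {g : ι → ℝ → ℝ} {S : ι → H →L[ℂ] H}
    {B : ℝ} (hB : 0 ≤ B) (hS : ∀ i, E.IsIntegral (g i) (S i)) (hg : ∀ i s, 0 ≤ g i s)
    (hsum : ∀ x, ∀ᵐ s ∂(E.measure x), Summable fun i => g i s)
    (hle : ∀ x, ∀ᵐ s ∂(E.measure x), ∑' i, g i s ≤ B) :
    ∃ S' : H →L[ℂ] H, (∀ x, HasSum (fun i => S i x) (S' x)) ∧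
      E.IsIntegral (fun s => ∑' i, g i s) S' := by
  have hfin0 : ∀ (t : Finset ι) (x : H), ∀ᵐ s ∂(E.measure x), 0 ≤ ∑ i ∈ t, g i s := fun t x =>
    ae_of_all _ fun s => Finset.sum_nonneg fun i _ => hg i s
  have hfinB : ∀ (t : Finset ι) (x : H), ∀ᵐ s ∂(E.measure x), ∑ i ∈ t, g i s ≤ B := by
    intro t x
    filter_upwards [hsum x, hle x] with s h1 h2
    exact (h1.sum_le_tsum t fun i _ => hg i s).trans h2
  have hfin : ∀ t : Finset ι, E.IsIntegral (fun s => ∑ i ∈ t, g i s) (∑ i ∈ t, S i) := fun t =>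
    IsIntegral.sum t fun i _ => hS i
  have hint : ∀ (t : Finset ι) (x : H), ∫ s, ∑ i ∈ t, g i s ∂(E.measure x) =
      ∑ i ∈ t, ∫ s, g i s ∂(E.measure x) := fun t x =>
    integral_finsetSum t fun i _ => (hS i x).1
  have hb : ∀ x, Summable fun i => ∫ s, g i s ∂(E.measure x) := by
    intro x
    refine summable_of_sum_le (c := B * ‖x‖ ^ 2) (fun i => integral_nonneg (hg i)) fun t => ?_
    rw [← hint]
    have := (hfin t).re_inner_le (hfinB t) x
    rwa [(hfin t x).2, Complex.ofReal_re] at this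
  have hsummable : ∀ x, Summable fun i => S i x := by
    intro x
    rw [summable_iff_vanishing_norm]
    intro ε hε
    -- A block has squared norm at most `B` times the sum of its scalar integrals; B + 1 keeps the
    -- divisor positive when B = 0.
    obtain ⟨s, hs⟩ := summable_iff_vanishing_norm.1 (hb x) (ε ^ 2 / (B + 1)) (by positivity)
    refine ⟨s, fun t ht => ?_⟩
    have h1 := (hfin t).norm_apply_sq_le (hfin0 t) (hfinB t) x
    rw [hint] at h1
    have h2 := (le_abs_self _).trans_lt (hs t ht)
    have h3 : (0 : ℝ) ≤ ∑ i ∈ t, ∫ s, g i s ∂(E.measure x) :=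
      Finset.sum_nonneg fun i _ => integral_nonneg (hg i)
    rw [lt_div_iff₀ (by positivity)] at h2
    rw [← sum_apply]
    refine lt_of_pow_lt_pow_left₀ 2 hε.le (h1.trans_lt ?_)
    linarith
  have hbound : ∀ x, ‖∑' i, S i x‖ ≤ B * ‖x‖ := by
    intro x
    refine le_of_tendsto (hsummable x).hasSum.norm (Eventually.of_forall fun t => ?_)
    rw [← sum_apply]
    exact ContinuousLinearMap.le_of_opNorm_le _
      ((hfin t).opNorm_le_of_nonneg hB (hfin0 t) (hfinB t)) x
  let S' : H →L[ℂ] H := LinearMap.mkContinuous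
    { toFun := fun x => ∑' i, S i x
      map_add' := fun x y => by
        simp only [map_add]
        exact (hsummable x).tsum_add (hsummable y)
      map_smul' := fun c x => by
        simp only [map_smul, RingHom.id_apply]
        exact (hsummable x).tsum_const_smul c } B hbound
  have hS' : ∀ x, HasSum (fun i => S i x) (S' x) := fun x => (hsummable x).hasSum
  refine ⟨S', hS', fun x => ⟨?_, ?_⟩⟩
  · refine Integrable.of_bound (C := B) ?_ ?_
    · refine aestronglyMeasurable_of_tendsto_ae (atTop : Filter (Finset ι))
        (f := fun t s => ∑ i ∈ t, g i s) (fun t => (hfin t x).1.aestronglyMeasurable) ?_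
      filter_upwards [hsum x] with s hs using hs.hasSum
    · filter_upwards [hle x] with s hs
      rwa [Real.norm_eq_abs, abs_of_nonneg (tsum_nonneg fun i => hg i s)]
  · have h1 : HasSum (fun i => ∫ s, g i s ∂(E.measure x)) (∫ s, ∑' i, g i s ∂(E.measure x)) := by
      refine hasSum_integral_of_summable_integral_norm (fun i => (hS i x).1) ?_
      simpa only [Real.norm_eq_abs, abs_of_nonneg (hg _ _)] using hb x
    have h2 := (Complex.hasSum_ofReal).2 h1
    have h3 := (hS' x).mapL (innerSL ℂ x)
    simp only [innerSL_apply_apply, fun i => (hS i x).2] at h3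
    exact h3.unique h2

end SpectralFamily

theorem tendsto_finset_Icc_neg_atTop :
    Tendsto (fun p : ℕ × ℕ => Finset.Icc (-(p.1 : ℤ)) (p.2 : ℤ)) (atTop ×ˢ atTop) atTop := by
  rw [prod_atTop_atTop_eq]
  refine tendsto_atTop_finset_of_monotone (fun p q h => ?_) fun k => ⟨(k.natAbs, k.natAbs), ?_⟩
  · have h1 := h.1
    have h2 := h.2
    exact Finset.Icc_subset_Icc (by omega) (by omega)
  · rw [Finset.mem_Icc]
    omega

/-! ### The theorem for `T`. -/

theorem lemma2p1 {H : Type*} [NormedAddCommGroup H] [InnerProductSpace ℂ H] [CompleteSpace H]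
    (T : H →ₗ.[ℂ] H) (hT : IsSelfAdjoint T)
    (hpos : ∀ x : T.domain, 0 ≤ (⟪(x : H), T x⟫_ℂ).re)
    (l : ℕ) (hl : 1 ≤ l)
    -- only the restriction of `f₀` to the half-line matters
    (f₀ : 𝓢(ℝ, ℂ)) (hf₀ : ∃ s : ℝ, 0 < s ∧ f₀ s ≠ 0)
    (f : ℝ → ℂ) (hf : ∀ s : ℝ, f s = (s : ℂ) ^ l * f₀ s)
    (c : ℝ) (hc : c = ∫ t in Ioi (0 : ℝ), ‖f t‖ ^ 2 / t) :
    -- (a)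
    (IntegrableOn (fun t : ℝ => ‖f t‖ ^ 2 / t) (Ioi 0) ∧
      (∀ ε N : ℝ, 0 < ε → ε < N →
        IntervalIntegrable (fun t : ℝ => ((t⁻¹ : ℝ) : ℂ) • T.absSqDilate f t) volume ε N) ∧
      ∀ F : H,
        Tendsto
          (fun p : ℝ × ℝ => (∫ t in p.1..p.2, ((t⁻¹ : ℝ) : ℂ) • T.absSqDilate f t) F)
          (𝓝[>] (0 : ℝ) ×ˢ atTop) (𝓝 (((c : ℂ) • (1 - T.nullProj)) F))) ∧
    -- (b)
    ∀ a A B : ℝ, 0 < a → a ≠ 1 → 0 < A →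
      (∀ s : ℝ, 0 < s →
        Summable (fun j : ℤ => ‖f (a ^ (2 * j) * s)‖ ^ 2) ∧
        A ≤ ∑' j : ℤ, ‖f (a ^ (2 * j) * s)‖ ^ 2 ∧
        ∑' j : ℤ, ‖f (a ^ (2 * j) * s)‖ ^ 2 ≤ B) →
      ∃ S : H →L[ℂ] H,
        (∀ F : H,
          Tendsto
            (fun p : ℕ × ℕ =>
              (∑ j ∈ Finset.Icc (-(p.1 : ℤ)) (p.2 : ℤ), T.absSqDilate f (a ^ (2 * j))) F)
            (atTop ×ˢ atTop) (𝓝 (S F))) ∧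
        (A : ℂ) • (1 - T.nullProj) ≤ S ∧ S ≤ (B : ℂ) • (1 - T.nullProj) := by
  obtain ⟨F, hF⟩ := f₀.exists_pow_mul_eq l
  obtain ⟨G, hG⟩ := f₀.exists_pow_mul_eq (l - 1)
  obtain rfl : f = F := funext fun s => (hf s).trans (hF s).symm
  have hF0 : F 0 = 0 := by
    rw [hF, Complex.ofReal_zero, zero_pow (by omega), zero_mul]
  have hint : IntegrableOn (fun t : ℝ => ‖F t‖ ^ 2 / t) (Ioi 0) :=
    SchwartzMap.integrableOn_norm_sq_div (G := G) fun s => by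
      rw [hF, hG, ← mul_assoc, ← pow_succ', Nat.sub_add_cancel hl]
  obtain ⟨E, hE, hcalc⟩ := LinearPMap.exists_isIntegral_funcCalc hT hpos
  have hnn := hE.ae_nonneg hpos
  have hS : ∀ t, 0 < t → E.IsIntegral (fun s => ‖F (t * s)‖ ^ 2) (T.absSqDilate F t) := fun t ht =>
    hcalc _ (F.continuous_norm_sq_dilate t) (F.tendsto_norm_sq_dilate ht.ne')
  rw [hE.nullProj_eq hT hpos]
  refine ⟨⟨hint, fun ε N hε hN => SpectralFamily.intervalIntegrable_dilate hS hε (hε.trans hN),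
    fun x => ?_⟩, fun a A B ha _ hA hAB => ?_⟩
  · rw [hc]
    exact SpectralFamily.tendsto_intervalIntegral_dilate hS hnn hF0 hint x
  · have hB : 0 ≤ B := hA.le.trans ((hAB 1 one_pos).2.1.trans (hAB 1 one_pos).2.2)
    have hsum : ∀ s : ℝ, 0 ≤ s → Summable fun j : ℤ => ‖F (a ^ (2 * j) * s)‖ ^ 2 := by
      intro s hs
      rcases hs.eq_or_lt with rfl | hs
      · simp [hF0, summable_zero]
      · exact (hAB s hs).1
    -- At s = 0 every term vanishes, so the bounds extend to [0, ∞) once they carry the indicator of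
    -- (0, ∞), which integrates to 1 - P_0.
    have hlow : ∀ s : ℝ, 0 ≤ s →
        A * (Ioi 0).indicator (fun _ => 1) s ≤ ∑' j : ℤ, ‖F (a ^ (2 * j) * s)‖ ^ 2 := by
      intro s hs
      rcases hs.eq_or_lt with rfl | hs
      · simp [hF0]
      · simpa [indicator, hs] using (hAB s hs).2.1
    have hupp : ∀ s : ℝ, 0 ≤ s →
        ∑' j : ℤ, ‖F (a ^ (2 * j) * s)‖ ^ 2 ≤ B * (Ioi 0).indicator (fun _ => 1) s := by
      intro s hs
      rcases hs.eq_or_lt with rfl | hs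
      · simp [hF0]
      · simpa [indicator, hs] using (hAB s hs).2.2
    obtain ⟨S, hS1, hS2⟩ := SpectralFamily.exists_hasSum_isIntegral hB
      (fun j : ℤ => hS (a ^ (2 * j)) (zpow_pos ha _)) (fun j s => by positivity)
      (fun x => (hnn x).mono hsum) (fun x => (hnn x).mono fun s hs => (hupp s hs).trans
        (mul_le_of_le_one_right hB (indicator_le_self' (fun _ _ => zero_le_one) s)))
    have hI := SpectralFamily.isIntegral_indicator_Ioi (E := E) 0
    refine ⟨S, fun x => ?_, ?_, ?_⟩
    · simp only [sum_apply]
      exact (hS1 x).comp tendsto_finset_Icc_neg_atTop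
    · exact (ContinuousLinearMap.le_def _ _).2 ((hS2.sub (hI.const_mul A)).isPositive fun x =>
        (hnn x).mono fun s hs => sub_nonneg.2 (hlow s hs))
    · exact (ContinuousLinearMap.le_def _ _).2 (((hI.const_mul B).sub hS2).isPositive fun x =>
        (hnn x).mono fun s hs => sub_nonneg.2 (hupp s hs))
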